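/- **Theorem.** Let $0<\alpha<1$, $0<\beta\le 1$ and $\lambda,\rho,\mu>0$. Let $\{N_\beta(t,\lambda)\}_{t\ge0}$ be a fractional Poisson process, that is, the renewal process with i.i.d. waiting times $W_k$ satisfying $P(W_k>t)=\sum_{j\ge 0}\frac{(-\lambda t^\beta)^j}{\Gamma(1+\beta j)}$ for $t\ge0$. Let $\{M(t)\}_{t\ge0}$ be an independent Mittag-Leffler Lévy subordinator, that is, a Lévy process with nondecreasing paths, $M(0)=0$ and $\mathbb{E}[e^{-uM(t)}]=\left(\frac{\mu}{\mu+u^\alpha}\right)^{\rho t}$ for $u\ge 0$. Let $\mathcal{G}(t)=N_\beta(M(t),\lambda)$ be the generalized fractional negative binomial process. Put $$q=\frac{\lambda}{\Gamma(1+\beta)},\qquad d=\beta q^2B(\beta,1+\beta),\qquad B(r,s)=\frac{\Gamma(r)\Gamma(s)}{\Gamma(r+s)},\qquad B(r,s;x)=\int_0^x u^{r-1}(1-u)^{s-1}\,du\quad(0\le x\le 1).$$ Let $0<s\le t<\infty$. (i) $\mathbb{E}[\mathcal{G}(t)]=q\,\mathbb{E}[M^\beta(t)]$ in $[0,\infty]$.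 If $\beta<\alpha$, both sides are finite and, as $t\to\infty$, $$\mathbb{E}[\mathcal{G}(t)]\sim\frac{q\,\Gamma(1-\frac{\beta}{\alpha})}{\mu^{\beta/\alpha}\,\Gamma(1-\beta)}(\rho t)^{\beta/\alpha}.$$ (ii) If $2\beta<\alpha$, then $\mathcal{G}(t)$ has a finite second moment and $$\operatorname{Var}[\mathcal{G}(t)]=q\,\mathbb{E}[M^\beta(t)]-q^2\left(\mathbb{E}[M^\beta(t)]\right)^2+2d\,\mathbb{E}[M^{2\beta}(t)],$$ all terms being finite. If only $\beta<\alpha$, then $\operatorname{Var}[\mathcal{G}(t)]+q^2\left(\mathbb{E}[M^\beta(t)]\right)^2=q\,\mathbb{E}[M^\beta(t)]+2d\,\mathbb{E}[M^{2\beta}(t)]$ holds in $[0,\infty]$. (iii) If $2\beta<\alpha$, then $$\operatorname{Cov}[\mathcal{G}(s),\mathcal{G}(t)]=q\,\mathbb{E}[M^\beta(s)]+d\,\mathbb{E}[M^{2\beta}(s)]-q^2\,\mathbb{E}[M^\beta(s)]\,\mathbb{E}[M^\beta(t)]+q^2\beta\,\mathbb{E}\!\left[M^{2\beta}(t)\,B\!\left(\beta,1+\beta;\tfrac{M(s)}{M(t)}\right)\right],$$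 all terms being finite. For every $0<\beta\le1$ one has in $[0,\infty]$ $$\mathbb{E}[\mathcal{G}(s)\mathcal{G}(t)]=q\,\mathbb{E}[M^\beta(s)]+d\,\mathbb{E}[M^{2\beta}(s)]+q^2\beta\,\mathbb{E}\!\left[M^{2\beta}(t)\,B\!\left(\beta,1+\beta;\tfrac{M(s)}{M(t)}\right)\right].$$ -/

import Mathlib

open MeasureTheory ProbabilityTheory Filter Asymptotics
open scoped NNReal ENNReal Topology

noncomputable section

/-- The one-parameter Mittag-Leffler function `E_β(z) = ∑ z ^ k / Γ(1 + β k)`, on the reals. -/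
def mittagLeffler (β z : ℝ) : ℝ :=
  ∑' k : ℕ, z ^ k / Real.Gamma (1 + β * k)

/-- The incomplete beta function `B(r, s; x) = ∫₀ˣ u ^ (r - 1) (1 - u) ^ (s - 1) du`. -/
def incompleteBeta (r s x : ℝ) : ℝ :=
  ∫ u in (0 : ℝ)..x, u ^ (r - 1) * (1 - u) ^ (s - 1)

/-- The renewal counting function of a sequence of waiting times:
`max {n ≥ 0 : w 0 + ⋯ + w (n - 1) ≤ t}`. -/
def renewalCount (w : ℕ → ℝ) (t : ℝ) : ℕ :=
  sSup {n : ℕ | ∑ i ∈ Finset.range n, w i ≤ t}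

/-- `N` is a fractional Poisson process of order `β` and rate `lam`: the renewal process with
i.i.d. waiting times `W k` of Mittag-Leffler law, `P (W k > t) = E_β(- lam * t ^ β)`, `t ≥ 0`. -/
structure IsFractionalPoissonProcess {Ω : Type*} [MeasurableSpace Ω] (β lam : ℝ)
    (N : ℝ≥0 → Ω → ℕ) (P : Measure Ω) : Prop where
  measurable : ∀ t, Measurable (N t)
  renewal : ∃ W : ℕ → Ω → ℝ,
    (∀ k, Measurable (W k)) ∧
    iIndepFun W P ∧
    (∀ k, ∀ t : ℝ, 0 ≤ t → P.real {ω | t < W k ω} = mittagLeffler β (-(lam * t ^ β))) ∧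
    ∀ᵐ ω ∂P, ∀ t : ℝ≥0, N t ω = renewalCount (fun k => W k ω) t

/-- `M` is a Mittag-Leffler Lévy subordinator with parameters `α`, `ρ`, `μ`: a Lévy process with
nondecreasing right-continuous paths, started at `0`, with Laplace transform
`E[exp (-u M(t))] = (μ / (μ + u ^ α)) ^ (ρ t)`, `u ≥ 0`. -/
structure IsMittagLefflerSubordinator {Ω : Type*} [MeasurableSpace Ω] (α ρ μ : ℝ)
    (M : ℝ≥0 → Ω → ℝ≥0) (P : Measure Ω) : Prop where
  measurable : ∀ t, Measurable (M t)
  zero : ∀ᵐ ω ∂P, M 0 ω = 0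
  indepIncrements : HasIndepIncrements (fun t ω => (M t ω : ℝ)) P
  stationaryIncrements : ∀ s t : ℝ≥0,
    IdentDistrib (fun ω => (M (s + t) ω : ℝ) - M s ω) (fun ω => (M t ω : ℝ)) P P
  paths : ∀ᵐ ω ∂P, Monotone (fun t => M t ω) ∧
    ∀ t, ContinuousWithinAt (fun r => M r ω) (Set.Ici t) t
  laplace : ∀ t : ℝ≥0, ∀ u : ℝ, 0 ≤ u →
    ∫ ω, Real.exp (-(u * M t ω)) ∂P = (μ / (μ + u ^ α)) ^ (ρ * t)

/-- The time change `t ↦ N (M t)` of a counting process `N` by a random clock `M`. -/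
def timeChange {Ω : Type*} (N : ℝ≥0 → Ω → ℕ) (M : ℝ≥0 → Ω → ℝ≥0) (t : ℝ≥0) (ω : Ω) : ℕ :=
  N (M t ω) ω

/-- `G` is a generalized fractional negative binomial process with subordinator `M`: the time
change of a fractional Poisson process by the independent Mittag-Leffler Lévy subordinator `M`. -/
structure IsGFNBP {Ω : Type*} [MeasurableSpace Ω] (α β lam ρ μ : ℝ)
    (G : ℝ≥0 → Ω → ℕ) (M : ℝ≥0 → Ω → ℝ≥0) (P : Measure Ω) : Prop where
  subordinator : IsMittagLefflerSubordinator α ρ μ M P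
  timeChanged : ∃ N : ℝ≥0 → Ω → ℕ, IsFractionalPoissonProcess β lam N P ∧
    IndepFun (fun ω t => N t ω) (fun ω t => M t ω) P ∧ G = timeChange N M

end

/-! Freeze the clock. Since `N` and `M` are independent, the first and mixed second moments of `N (M
t)` are those of `N` at deterministic times, averaged over `M` (`lintegral_timeChange`). Everything
then rests on the renewal measure of `N` and on the fractional moments of `M`.

For `N`, write `N t = ∑_{n ≥ 1} 1{S n ≤ t}` with renewal epochs `S n`. The sum over `n ≥ 1` of the
laws of `S n` is the measure `U` with density `q β u^(β-1)` on `(0, ∞)` (`sum_map_renewalEpoch`).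
Indeed, convolving the survival function of a waiting time with the laws of all `S n`, `n ≥ 0`,
telescopes to the indicator of `[0, ∞)`, and convolving it with `δ₀ + U` gives the same function by
termwise beta integrals; such a convolution inverse is unique
(`measure_Iic_eq_of_lintegral_sub_eq`). Hence `E N t = U(Iic t) = q t^β`. In `E[N s N t]` the double
sum splits into the diagonal and two strict triangles, each triangle being an integral of `U(Iic (t
- u))` against `U(du)`, that is, an incomplete beta function.

For `M`, the identity `∫₀^∞ (1 - e^(-ux)) u^(-p-1) du = x^p Γ(1-p)/p`, `0 < p < 1`, expresses
`E[M^p]` through the Laplace transform. The bound `(μ/(μ+x))^r ≥ e^(-rx/μ)` makes it finite for `p <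
α`; the scaling `u = r^(-1/α) v` with `r = ρt` extracts `r^(p/α)`, and dominated convergence gives
the constant. -/

/-! ### Beta integrals and the Mittag-Leffler series -/

theorem incompleteBeta_one {r s : ℝ} (hr : 0 < r) (hs : 0 < s) :
    incompleteBeta r s 1 = beta r s := by
  have h1 : ((incompleteBeta r s 1 : ℝ) : ℂ) = Complex.betaIntegral r s := by
    unfold incompleteBeta Complex.betaIntegral
    rw [← intervalIntegral.integral_ofReal]
    refine intervalIntegral.integral_congr fun x hx => ?_
    rw [Set.uIcc_of_le zero_le_one] at hx
    push_cast
    rw [Complex.ofReal_cpow hx.1, Complex.ofReal_cpow (by linarith [hx.2])]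
    push_cast
    rfl
  rw [beta_eq_betaIntegralReal r s hr hs, ← h1, Complex.ofReal_re]

theorem intervalIntegral_rpow_mul_sub_rpow (r p : ℝ) {s t : ℝ} (hs : 0 ≤ s) (ht : 0 < t)
    (hst : s ≤ t) :
    ∫ u in (0 : ℝ)..s, u ^ (r - 1) * (t - u) ^ (p - 1)
      = t ^ (r + p - 1) * incompleteBeta r p (s / t) := by
  have h := intervalIntegral.smul_integral_comp_mul_left (a := 0) (b := s / t)
    (fun u : ℝ => u ^ (r - 1) * (t - u) ^ (p - 1)) t
  rw [mul_zero, mul_div_cancel₀ _ ht.ne'] at h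
  rw [← h, incompleteBeta, smul_eq_mul, ← intervalIntegral.integral_const_mul,
    ← intervalIntegral.integral_const_mul]
  refine intervalIntegral.integral_congr fun x hx => ?_
  rw [Set.uIcc_of_le (div_nonneg hs ht.le)] at hx
  have hx1 : x ≤ 1 := hx.2.trans ((div_le_one ht).2 hst)
  have h2 : t - t * x = t * (1 - x) := by ring
  have h3 : t ^ (r + p - 1) = t * t ^ (r - 1) * t ^ (p - 1) := by
    nth_rewrite 2 [← Real.rpow_one t]
    rw [← Real.rpow_add ht, ← Real.rpow_add ht]
    congr 1; ring
  rw [h2, Real.mul_rpow ht.le hx.1, Real.mul_rpow ht.le (by linarith), h3]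
  ring

theorem intervalIntegrable_rpow_mul_sub_rpow {r p : ℝ} (hr : 0 < r) (hp : 1 ≤ p) (s t : ℝ) :
    IntervalIntegrable (fun u : ℝ => u ^ (r - 1) * (t - u) ^ (p - 1)) volume 0 s := by
  refine (intervalIntegral.intervalIntegrable_rpow' (by linarith)).mul_continuousOn ?_
  exact ((continuous_const.sub continuous_id).rpow_const
    fun _ => Or.inr (by linarith)).continuousOn

/-- Keep only the part of the gamma integral over `(R, R + 1]`. As `R` is free, Γ outgrows every
geometric sequence. -/
theorem rpow_mul_exp_neg_le_Gamma_add_one {R x : ℝ} (hR : 0 < R) (hx : 0 ≤ x) :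
    R ^ x * Real.exp (-(R + 1)) ≤ Real.Gamma (x + 1) := by
  rw [Real.Gamma_eq_integral (by linarith)]
  have hint := Real.GammaIntegral_convergent (s := x + 1) (by linarith)
  have hsub : Set.Ioc R (R + 1) ⊆ Set.Ioi 0 := fun y hy => hR.trans hy.1
  calc R ^ x * Real.exp (-(R + 1))
      = ∫ _ in Set.Ioc R (R + 1), R ^ x * Real.exp (-(R + 1)) := by simp
    _ ≤ ∫ y in Set.Ioc R (R + 1), Real.exp (-y) * y ^ (x + 1 - 1) := by
        refine setIntegral_mono_on (integrableOn_const (by simp) enorm_ne_top) (hint.mono_set hsub)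
          measurableSet_Ioc fun y hy => ?_
        rw [add_sub_cancel_right, mul_comm]
        refine mul_le_mul (Real.exp_le_exp.2 (by linarith [hy.2]))
          (Real.rpow_le_rpow hR.le hy.1.le hx) (by positivity) (by positivity)
    _ ≤ _ := by
        refine setIntegral_mono_set hint ?_ (LE.le.eventuallyLE hsub)
        filter_upwards [self_mem_ae_restrict measurableSet_Ioi] with y hy
        have : (0 : ℝ) < y := hy
        simp only [Pi.zero_apply]
        positivity

theorem summable_mittagLeffler {β : ℝ} (hβ : 0 < β) (z : ℝ) :
    Summable fun k : ℕ => z ^ k / Real.Gamma (1 + β * k) := by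
  -- `R` is chosen so that `R ^ β = 2 (|z| + 1)`, which leaves a geometric majorant of ratio `1/2`.
  set R : ℝ := (2 * (|z| + 1)) ^ β⁻¹ with hR
  have hz : 0 < 2 * (|z| + 1) := by positivity
  have hR0 : 0 < R := Real.rpow_pos_of_pos hz _
  have hRβ : R ^ β = 2 * (|z| + 1) := by
    rw [hR, ← Real.rpow_mul hz.le, inv_mul_cancel₀ hβ.ne', Real.rpow_one]
  refine Summable.of_norm_bounded
    (g := fun k : ℕ => Real.exp (R + 1) * (1 / 2 : ℝ) ^ k)
    (summable_geometric_two.mul_left _) fun k => ?_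
  have h1 := rpow_mul_exp_neg_le_Gamma_add_one hR0 (x := β * k) (by positivity)
  rw [Real.rpow_mul hR0.le, hRβ, Real.rpow_natCast, Real.exp_neg, add_comm (β * k)] at h1
  have hG : 0 < Real.Gamma (1 + β * k) := Real.Gamma_pos_of_pos (by positivity)
  rw [norm_div, norm_pow, Real.norm_eq_abs, Real.norm_of_nonneg hG.le, div_le_iff₀ hG]
  calc |z| ^ k ≤ (|z| + 1) ^ k := by gcongr; linarith
    _ = Real.exp (R + 1) * (1 / 2 : ℝ) ^ k
        * ((2 * (|z| + 1)) ^ k * (Real.exp (R + 1))⁻¹) := by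
        have : Real.exp (R + 1) ≠ 0 := (Real.exp_pos _).ne'
        rw [mul_pow]; field_simp
        rw [← mul_pow]; norm_num
    _ ≤ _ := by gcongr

theorem mittagLeffler_zero (β : ℝ) : mittagLeffler β 0 = 1 := by
  rw [mittagLeffler, tsum_eq_single 0 fun k hk => by simp [hk]]
  simp

/-- Convolving the `k`-th term of the series with the power density is a beta integral, equal to
minus the term of index `k + 1`. The sum is thus the series without its constant term, up to sign.
-/
theorem integral_mittagLeffler_mul_rpow {β lam t : ℝ} (hβ : 0 < β) (hlam : 0 < lam) (ht : 0 < t) :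
    ∫ u in Set.Ioc 0 t, mittagLeffler β (-(lam * (t - u) ^ β))
        * (lam / Real.Gamma (1 + β) * β * u ^ (β - 1))
      = 1 - mittagLeffler β (-(lam * t ^ β)) := by
  have hΓβ : 0 < Real.Gamma β := Real.Gamma_pos_of_pos hβ
  have hq : lam / Real.Gamma (1 + β) * β = lam / Real.Gamma β := by
    rw [add_comm, Real.Gamma_add_one hβ.ne']; field_simp
  have hΓ (k : ℕ) : 0 < Real.Gamma (1 + β * k) := Real.Gamma_pos_of_pos (by positivity)
  set F : ℕ → ℝ → ℝ := fun k u => (-(lam * (t - u) ^ β)) ^ k / Real.Gamma (1 + β * k)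
    * (lam / Real.Gamma (1 + β) * β * u ^ (β - 1)) with hF
  have hFeq (k : ℕ) {u : ℝ} (hu : u ∈ Set.Ioc 0 t) : F k u =
      (-1) ^ k * (lam ^ (k + 1) / (Real.Gamma (1 + β * k) * Real.Gamma β))
        * (u ^ (β - 1) * (t - u) ^ (1 + β * k - 1)) := by
    have h1 : (t - u) ^ (1 + β * k - 1) = ((t - u) ^ β) ^ k := by
      rw [add_sub_cancel_left, Real.rpow_mul (by linarith [hu.2]), Real.rpow_natCast]
    simp only [hF]
    rw [hq, h1, ← neg_one_mul, mul_pow, mul_pow]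
    field_simp
    ring
  have hint (k : ℕ) : ∫ u in Set.Ioc 0 t, u ^ (β - 1) * (t - u) ^ (1 + β * k - 1)
      = t ^ (β * (k + 1)) *
        (Real.Gamma β * Real.Gamma (1 + β * k) / Real.Gamma (1 + β * (k + 1))) := by
    rw [← intervalIntegral.integral_of_le ht.le,
      intervalIntegral_rpow_mul_sub_rpow _ _ ht.le ht le_rfl, div_self ht.ne',
      incompleteBeta_one hβ (by positivity), beta]
    congr 2 <;> ring_nf
  have hI (k : ℕ) : IntegrableOn (fun u : ℝ => u ^ (β - 1) * (t - u) ^ (1 + β * k - 1))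
      (Set.Ioc 0 t) :=
    (intervalIntegrable_iff_integrableOn_Ioc_of_le ht.le).1
      (intervalIntegrable_rpow_mul_sub_rpow hβ (by simp; positivity) t t)
  have hval (k : ℕ) : ∫ u in Set.Ioc 0 t, F k u
      = -((-(lam * t ^ β)) ^ (k + 1) / Real.Gamma (1 + β * (k + 1 : ℕ))) := by
    rw [setIntegral_congr_fun measurableSet_Ioc fun u hu => hFeq k hu, integral_const_mul, hint,
      Real.rpow_mul ht.le, ← Nat.cast_add_one, Real.rpow_natCast, ← neg_one_mul (lam * _),
      mul_pow, mul_pow]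
    have := (hΓ k).ne'
    have := (hΓ (k + 1)).ne'
    field_simp
    ring
  have hnorm (k : ℕ) : ∫ u in Set.Ioc 0 t, ‖F k u‖
      = (lam * t ^ β) ^ (k + 1) / Real.Gamma (1 + β * (k + 1 : ℕ)) := by
    have : ∀ u ∈ Set.Ioc 0 t, ‖F k u‖
        = lam ^ (k + 1) / (Real.Gamma (1 + β * k) * Real.Gamma β)
        * (u ^ (β - 1) * (t - u) ^ (1 + β * k - 1)) := fun u hu => by
      have h0 := (hΓ k).le
      have h1 : 0 ≤ u ^ (β - 1) := Real.rpow_nonneg hu.1.le _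
      have h2 : 0 ≤ (t - u) ^ (1 + β * k - 1) := Real.rpow_nonneg (by linarith [hu.2]) _
      rw [hFeq k hu, norm_mul, norm_mul, norm_pow, norm_neg, norm_one, one_pow, one_mul,
        Real.norm_of_nonneg (by positivity), Real.norm_of_nonneg (by positivity)]
    rw [setIntegral_congr_fun measurableSet_Ioc this, integral_const_mul, hint,
      Real.rpow_mul ht.le, ← Nat.cast_add_one, Real.rpow_natCast, mul_pow]
    have := (hΓ k).ne'
    have := (hΓ (k + 1)).ne'
    field_simp
  have hFint (k : ℕ) : Integrable (F k) (volume.restrict (Set.Ioc 0 t)) :=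
    ((hI k).const_mul _).congr
      ((ae_restrict_iff' measurableSet_Ioc).2 (ae_of_all _ fun u hu => (hFeq k hu).symm))
  have key := hasSum_integral_of_summable_integral_norm hFint (by
    simp_rw [hnorm]
    exact (summable_nat_add_iff 1).2 (summable_mittagLeffler hβ (lam * t ^ β)))
  simp only [hF, tsum_mul_right] at key
  rw [mittagLeffler, (summable_mittagLeffler hβ _).tsum_eq_zero_add]
  simp only [mittagLeffler]
  rw [← key.tsum_eq]
  have := hval
  simp only [hF] at this
  simp_rw [this, tsum_neg]
  simp

/-- Taking `H` to be a survival function supplies measurability, positivity and the bound by `1`,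
none of which is apparent from the alternating series. -/
theorem lintegral_survival_mul_rpow {β lam : ℝ} (hβ : 0 < β) (hlam : 0 < lam) {H : ℝ → ℝ}
    (hH : Antitone H) (hH0 : ∀ x, 0 ≤ H x) (hH1 : ∀ x, H x ≤ 1)
    (hml : ∀ x, 0 ≤ x → H x = mittagLeffler β (-(lam * x ^ β))) {t : ℝ} (ht : 0 ≤ t) :
    ∫⁻ u in Set.Ioc 0 t, ENNReal.ofReal (H (t - u))
        * ENNReal.ofReal (lam / Real.Gamma (1 + β) * β * u ^ (β - 1))
      = ENNReal.ofReal (1 - H t) := by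
  have hΓ : 0 < Real.Gamma (1 + β) := Real.Gamma_pos_of_pos (by positivity)
  rcases ht.eq_or_lt with rfl | ht
  · simp [hml 0 le_rfl, Real.zero_rpow hβ.ne', mittagLeffler_zero]
  rw [hml t ht.le, ← integral_mittagLeffler_mul_rpow hβ hlam ht]
  have hI : IntegrableOn (fun u : ℝ => lam / Real.Gamma (1 + β) * β * u ^ (β - 1))
      (Set.Ioc 0 t) :=
    ((intervalIntegrable_iff_integrableOn_Ioc_of_le ht.le).1
      (intervalIntegral.intervalIntegrable_rpow' (by linarith))).const_mul _
  have hmeas : Measurable fun u => H (t - u) := hH.measurable.comp (by fun_prop)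
  rw [setIntegral_congr_fun (g := fun u => H (t - u)
    * (lam / Real.Gamma (1 + β) * β * u ^ (β - 1))) measurableSet_Ioc
    fun u hu => by simp only; rw [hml _ (by linarith [hu.2])]]
  rw [ofReal_integral_eq_lintegral_ofReal]
  · simp_rw [ENNReal.ofReal_mul (hH0 _)]
  · exact hI.bdd_mul (c := 1) hmeas.aestronglyMeasurable
      (ae_of_all _ fun u => by rw [Real.norm_of_nonneg (hH0 _)]; exact hH1 _)
  · filter_upwards [self_mem_ae_restrict measurableSet_Ioc] with u hu
    have := Real.rpow_nonneg hu.1.le (β - 1)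
    have := hH0 (t - u)
    simp only [Pi.zero_apply]
    positivity

/-! ### Uniqueness in the renewal equation and the power renewal measure -/

/-- Associativity and commutativity of convolution: with `e` the indicator of `[0, ∞)`, `A ∗ e = A ∗
(B ∗ k) = B ∗ (A ∗ k) = B ∗ e`. By Tonelli this needs no finiteness. -/
theorem measure_Iic_eq_of_lintegral_sub_eq {A B : Measure ℝ} [SFinite A] [SFinite B]
    {k : ℝ → ℝ≥0∞} (hk : Measurable k)
    (hA : ∀ x, ∫⁻ v, k (x - v) ∂A = (Set.Ici (0 : ℝ)).indicator 1 x)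
    (hB : ∀ x, ∫⁻ v, k (x - v) ∂B = (Set.Ici (0 : ℝ)).indicator 1 x) (t : ℝ) :
    A (Set.Iic t) = B (Set.Iic t) := by
  have h (C : Measure ℝ) : C (Set.Iic t) = ∫⁻ u, (Set.Ici (0 : ℝ)).indicator 1 (t - u) ∂C := by
    rw [← lintegral_indicator_one measurableSet_Iic]
    refine lintegral_congr fun u => ?_
    simp [Set.indicator_apply]
  rw [h A, h B]
  simp_rw [← hB]
  rw [lintegral_lintegral_swap]
  · simp_rw [sub_right_comm t, hA, hB]
  · exact (hk.comp (by fun_prop)).aemeasurable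

/-- The measure on `(0, ∞)` with density `lam * β * u ^ (β - 1) / Γ(1 + β)`. -/
noncomputable def powerRenewalMeasure (β lam : ℝ) : Measure ℝ :=
  (volume.restrict (Set.Ioi 0)).withDensity
    fun u => ENNReal.ofReal (lam / Real.Gamma (1 + β) * β * u ^ (β - 1))

instance (β lam : ℝ) : SFinite (powerRenewalMeasure β lam) := by
  unfold powerRenewalMeasure; infer_instance

theorem lintegral_powerRenewalMeasure (β lam : ℝ) {f : ℝ → ℝ≥0∞} (hf : Measurable f) :
    ∫⁻ u, f u ∂(powerRenewalMeasure β lam) = ∫⁻ u in Set.Ioi 0,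
      f u * ENNReal.ofReal (lam / Real.Gamma (1 + β) * β * u ^ (β - 1)) := by
  rw [powerRenewalMeasure, lintegral_withDensity_eq_lintegral_mul _ (by fun_prop) hf]
  simp [mul_comm]

theorem setLIntegral_powerRenewalMeasure (β lam : ℝ) {f : ℝ → ℝ≥0∞} (hf : Measurable f) (t : ℝ) :
    ∫⁻ u in Set.Iic t, f u ∂(powerRenewalMeasure β lam) = ∫⁻ u in Set.Ioc 0 t,
      f u * ENNReal.ofReal (lam / Real.Gamma (1 + β) * β * u ^ (β - 1)) := by
  rw [← lintegral_indicator measurableSet_Iic,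
    lintegral_powerRenewalMeasure _ _ (hf.indicator measurableSet_Iic), ← Set.Ioi_inter_Iic,
    Set.inter_comm, ← Measure.restrict_restrict measurableSet_Iic,
    ← lintegral_indicator measurableSet_Iic]
  refine lintegral_congr fun u => ?_
  by_cases h : u ∈ Set.Iic t <;> simp [h]

theorem powerRenewalMeasure_Iic {β lam : ℝ} (hβ : 0 < β) (hlam : 0 < lam) {t : ℝ} (ht : 0 ≤ t) :
    powerRenewalMeasure β lam (Set.Iic t)
      = ENNReal.ofReal (lam / Real.Gamma (1 + β) * t ^ β) := by
  have hΓ : 0 < Real.Gamma (1 + β) := Real.Gamma_pos_of_pos (by positivity)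
  rw [← setLIntegral_one, setLIntegral_powerRenewalMeasure _ _ measurable_const]
  simp_rw [one_mul]
  rw [← ofReal_integral_eq_lintegral_ofReal]
  · rw [integral_const_mul, ← intervalIntegral.integral_of_le ht,
      integral_rpow (Or.inl (by linarith)), sub_add_cancel, Real.zero_rpow hβ.ne']
    congr 1; field_simp; ring
  · exact ((intervalIntegrable_iff_integrableOn_Ioc_of_le ht).1
      (intervalIntegral.intervalIntegrable_rpow' (by linarith))).const_mul _
  · filter_upwards [self_mem_ae_restrict measurableSet_Ioc] with u hu
    have := Real.rpow_nonneg hu.1.le (β - 1)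
    simp only [Pi.zero_apply]
    positivity

theorem setLIntegral_powerRenewalMeasure_Iic_sub {β lam : ℝ} (hβ : 0 < β) (hlam : 0 < lam)
    {s t : ℝ} (hs : 0 ≤ s) (hst : s ≤ t) :
    ∫⁻ u in Set.Iic s, powerRenewalMeasure β lam (Set.Iic (t - u)) ∂(powerRenewalMeasure β lam)
      = ENNReal.ofReal ((lam / Real.Gamma (1 + β)) ^ 2 * β * (t ^ (2 * β)
          * incompleteBeta β (1 + β) (s / t))) := by
  have hΓ : 0 < Real.Gamma (1 + β) := Real.Gamma_pos_of_pos (by positivity)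
  have hm : Measurable fun u => powerRenewalMeasure β lam (Set.Iic (t - u)) :=
    Antitone.measurable fun a b hab => measure_mono (Set.Iic_subset_Iic.2 (by linarith))
  -- For `s = 0` the time `t` may vanish too, so the rescaling by `t` is unavailable; both sides are
  -- zero.
  rcases hs.eq_or_lt with rfl | hs
  · rw [setLIntegral_powerRenewalMeasure _ _ hm]
    simp [incompleteBeta]
  have ht : 0 < t := hs.trans_le hst
  have h2 : t ^ (2 * β) = t ^ (β + (1 + β) - 1) := by congr 1; ring
  rw [h2, ← intervalIntegral_rpow_mul_sub_rpow β (1 + β) hs.le ht hst,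
    ← intervalIntegral.integral_const_mul, intervalIntegral.integral_of_le hs.le,
    ofReal_integral_eq_lintegral_ofReal, setLIntegral_powerRenewalMeasure _ _ hm]
  · refine setLIntegral_congr_fun measurableSet_Ioc fun u hu => ?_
    have h0 : 0 ≤ t - u := by linarith [hu.2]
    rw [powerRenewalMeasure_Iic hβ hlam h0, ← ENNReal.ofReal_mul (by positivity)]
    congr 1
    rw [add_sub_cancel_left]; ring
  · exact ((intervalIntegrable_iff_integrableOn_Ioc_of_le hs.le).1
      (intervalIntegrable_rpow_mul_sub_rpow hβ (by linarith) s t)).const_mul _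
  · filter_upwards [self_mem_ae_restrict measurableSet_Ioc] with u hu
    have := Real.rpow_nonneg hu.1.le (β - 1)
    have := Real.rpow_nonneg (show 0 ≤ t - u by linarith [hu.2]) (1 + β - 1)
    simp only [Pi.zero_apply]
    positivity

/-! ### Renewal epochs of general positive i.i.d. waiting times -/

/-- The `n`-th renewal epoch of a sequence of waiting times. -/
def renewalEpoch {Ω : Type*} (W : ℕ → Ω → ℝ) (n : ℕ) (ω : Ω) : ℝ :=
  ∑ i ∈ Finset.range n, W i ω

section Renewal

variable {Ω : Type*} [MeasurableSpace Ω] {P : Measure Ω} {W : ℕ → Ω → ℝ}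

theorem measurable_renewalEpoch (hW : ∀ k, Measurable (W k)) (n : ℕ) :
    Measurable (renewalEpoch W n) :=
  Finset.measurable_fun_sum _ fun i _ => hW i

theorem indepFun_renewalEpoch (hW : ∀ k, Measurable (W k)) (hi : iIndepFun W P) (k m : ℕ) :
    IndepFun (renewalEpoch W k) (renewalEpoch (fun i => W (k + i)) m) P := by
  have h := iIndepFun.indepFun_finset (Finset.range k) (Finset.Ico k (k + m))
    (by rw [Finset.range_eq_Ico]; exact Finset.Ico_disjoint_Ico_consecutive 0 k (k + m)) hi hW
  have h2 := h.comp (φ := fun f => ∑ i, f i) (ψ := fun f => ∑ i, f i)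
    (by fun_prop) (by fun_prop)
  convert h2 using 1
  · ext ω
    simp only [renewalEpoch, Function.comp]
    rw [Finset.sum_coe_sort (Finset.range k) fun i => W i ω]
  · ext ω
    simp only [renewalEpoch, Function.comp]
    rw [Finset.sum_coe_sort (Finset.Ico k (k + m)) fun i => W i ω, Finset.sum_Ico_eq_sum_range]
    simp

variable [IsProbabilityMeasure P]

theorem map_renewalEpoch_add (hW : ∀ k, Measurable (W k)) (hi : iIndepFun W P)
    (hid : ∀ k, P.map (W k) = P.map (W 0)) (k m : ℕ) :
    P.map (renewalEpoch (fun i => W (k + i)) m) = P.map (renewalEpoch W m) := by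
  have hrec (k m : ℕ) : P.map (renewalEpoch (fun i => W (k + i)) (m + 1))
      = P.map (renewalEpoch (fun i => W (k + i)) m) ∗ P.map (W 0) := by
    have hi' : iIndepFun (fun i => W (k + i)) P := hi.precomp (add_right_injective k)
    have h1 : renewalEpoch (fun i => W (k + i)) (m + 1)
        = renewalEpoch (fun i => W (k + i)) m + W (k + m) := by
      ext ω; simp [renewalEpoch, Finset.sum_range_succ]
    rw [h1, IndepFun.map_add_eq_map_conv_map (measurable_renewalEpoch (fun i => hW (k + i)) m)
      (hW _) ?_, hid]
    have := indepFun_renewalEpoch (fun i => hW (k + i)) hi' m 1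
    have h2 : renewalEpoch (fun i => W (k + (m + i))) 1 = W (k + m) := by
      ext ω; simp [renewalEpoch]
    rwa [h2] at this
  induction m with
  | zero => rfl
  | succ m ih =>
    have h0 := hrec 0 m
    simp only [zero_add] at h0
    rw [hrec, ih, h0]

/-- Condition on the `k`-th epoch: the next `m` waiting times are independent of it and their sum is
distributed as the `m`-th epoch. -/
theorem measure_Iic_sub_renewal (hW : ∀ k, Measurable (W k)) (hi : iIndepFun W P)
    (hid : ∀ k, P.map (W k) = P.map (W 0)) {A : Set ℝ} (hA : MeasurableSet A) (k m : ℕ) (t : ℝ) :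
    P {ω | renewalEpoch W k ω ∈ A ∧ renewalEpoch W (k + m) ω ≤ t}
      = ∫⁻ u in A, P.map (renewalEpoch W m) (Set.Iic (t - u)) ∂(P.map (renewalEpoch W k)) := by
  have hSk := measurable_renewalEpoch hW k
  have hS' := measurable_renewalEpoch (fun i => hW (k + i)) m
  have hprod := (indepFun_iff_map_prod_eq_prod_map_map hSk.aemeasurable hS'.aemeasurable).1
    (indepFun_renewalEpoch hW hi k m)
  rw [map_renewalEpoch_add hW hi hid] at hprod
  have hB : MeasurableSet {p : ℝ × ℝ | p.1 ∈ A ∧ p.1 + p.2 ≤ t} :=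
    (measurable_fst hA).inter (measurableSet_le (measurable_fst.add measurable_snd) measurable_const)
  have h1 : {ω | renewalEpoch W k ω ∈ A ∧ renewalEpoch W (k + m) ω ≤ t}
      = (fun ω => (renewalEpoch W k ω, renewalEpoch (fun i => W (k + i)) m ω)) ⁻¹'
        {p : ℝ × ℝ | p.1 ∈ A ∧ p.1 + p.2 ≤ t} := by
    ext ω
    simp [renewalEpoch, Finset.sum_range_add]
  have := Measure.isProbabilityMeasure_map (μ := P) (measurable_renewalEpoch hW m).aemeasurable
  rw [h1, ← Measure.map_apply (hSk.prodMk hS') hB, hprod, Measure.prod_apply hB,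
    ← lintegral_indicator hA]
  refine lintegral_congr fun u => ?_
  by_cases hu : u ∈ A
  · simp only [hu, Set.indicator_of_mem]
    congr 1
    ext v
    simp [hu, le_sub_iff_add_le']
  · simp [hu]

/-- Chernoff bound at parameter `-1`: positivity gives `E[e^(-W)] < 1`, and the transform of the
`n`-th epoch is its `n`-th power. No moment of `W` is required. -/
theorem tendsto_measure_renewalEpoch_le (hW : ∀ k, Measurable (W k)) (hi : iIndepFun W P)
    (hid : ∀ k, P.map (W k) = P.map (W 0)) (hpos : ∀ k, ∀ᵐ ω ∂P, 0 < W k ω) (x : ℝ) :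
    Tendsto (fun n => P {ω | renewalEpoch W n ω ≤ x}) atTop (𝓝 0) := by
  have hI (k : ℕ) : Integrable (fun ω => Real.exp (-1 * W k ω)) P := by
    refine Integrable.of_bound (by fun_prop) 1 ?_
    filter_upwards [hpos k] with ω hω
    rw [Real.norm_eq_abs, Real.abs_exp]
    exact Real.exp_le_one_iff.2 (by linarith)
  have hL (k : ℕ) : mgf (W k) P (-1) = mgf (W 0) P (-1) := by
    rw [← mgf_id_map (hW k).aemeasurable, hid, mgf_id_map (hW 0).aemeasurable]
  have hL1 : mgf (W 0) P (-1) < 1 := by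
    have h : 0 < ∫ ω, (1 - Real.exp (-1 * W 0 ω)) ∂P := by
      rw [integral_pos_iff_support_of_nonneg_ae]
      · have : ∀ᵐ ω ∂P, ω ∈ Function.support fun ω => 1 - Real.exp (-1 * W 0 ω) := by
          filter_upwards [hpos 0] with ω hω
          have : Real.exp (-1 * W 0 ω) < 1 := Real.exp_lt_one_iff.2 (by linarith)
          simp only [Function.mem_support]
          linarith
        have h1 : P (Function.support fun ω => 1 - Real.exp (-1 * W 0 ω)) = 1 :=
          (measure_congr (eventuallyEq_univ.2 this)).trans measure_univ
        rw [h1]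
        exact zero_lt_one
      · filter_upwards [hpos 0] with ω hω
        have : Real.exp (-1 * W 0 ω) < 1 := Real.exp_lt_one_iff.2 (by linarith)
        simp only [Pi.zero_apply]
        linarith
      · exact (integrable_const 1).sub (hI 0)
    rw [integral_sub (integrable_const 1) (hI 0)] at h
    simp only [integral_const, probReal_univ, smul_eq_mul, mul_one] at h
    rw [mgf]; linarith
  have hS (n : ℕ) : mgf (renewalEpoch W n) P (-1) = mgf (W 0) P (-1) ^ n := by
    have h1 : renewalEpoch W n = ∑ i ∈ Finset.range n, W i := by
      ext ω; simp [renewalEpoch]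
    rw [h1, hi.mgf_sum hW]
    simp [hL]
  have hSpos (n : ℕ) : ∀ᵐ ω ∂P, 0 ≤ renewalEpoch W n ω := by
    filter_upwards [ae_all_iff.2 hpos] with ω hω
    exact Finset.sum_nonneg fun i _ => (hω i).le
  have hb (n : ℕ) : P.real {ω | renewalEpoch W n ω ≤ x}
      ≤ Real.exp (- -1 * x) * mgf (W 0) P (-1) ^ n := by
    rw [← hS]
    refine measure_le_le_exp_mul_mgf x (by norm_num) ?_
    refine Integrable.of_bound (by have := measurable_renewalEpoch hW n; fun_prop) 1 ?_
    filter_upwards [hSpos n] with ω hω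
    rw [Real.norm_eq_abs, Real.abs_exp]
    exact Real.exp_le_one_iff.2 (by linarith)
  have hlim : Tendsto (fun n => P.real {ω | renewalEpoch W n ω ≤ x}) atTop (𝓝 0) := by
    refine squeeze_zero (fun n => measureReal_nonneg) hb ?_
    simpa using (tendsto_pow_atTop_nhds_zero_of_lt_one mgf_nonneg hL1).const_mul
      (Real.exp (- -1 * x))
  have := ENNReal.tendsto_ofReal hlim
  simpa [ofReal_measureReal] using this

/-- Survival function plus distribution function is the indicator of `[0, ∞)`. Convolved with the
law of the `n`-th epoch `S n`, the survival function therefore yields `P(S n ≤ x) - P(S (n+1) ≤ x)`;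
the sum telescopes and the remainder vanishes. -/
theorem lintegral_survival_sum_map_renewalEpoch (hW : ∀ k, Measurable (W k)) (hi : iIndepFun W P)
    (hid : ∀ k, P.map (W k) = P.map (W 0)) (hpos : ∀ k, ∀ᵐ ω ∂P, 0 < W k ω) (x : ℝ) :
    ∫⁻ v, (Set.Ici (0 : ℝ)).indicator (fun y => P.map (W 0) (Set.Ioi y)) (x - v)
        ∂(Measure.sum fun n => P.map (renewalEpoch W n))
      = (Set.Ici (0 : ℝ)).indicator 1 x := by
  have := Measure.isProbabilityMeasure_map (μ := P) (hW 0).aemeasurable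
  set k : ℝ → ℝ≥0∞ := (Set.Ici (0 : ℝ)).indicator fun y => P.map (W 0) (Set.Ioi y) with hk
  have hkm : Measurable k := Measurable.indicator
    (Antitone.measurable fun a b hab => measure_mono (Set.Ioi_subset_Ioi hab)) measurableSet_Ici
  have hadd (y : ℝ) : k y + P.map (W 0) (Set.Iic y) = (Set.Ici (0 : ℝ)).indicator 1 y := by
    by_cases hy : 0 ≤ y
    · have h := measure_add_measure_compl (μ := P.map (W 0)) (measurableSet_Iic (a := y))
      simp only [hk, Set.indicator_of_mem (show y ∈ Set.Ici (0 : ℝ) from hy), Pi.one_apply]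
      rw [add_comm, ← Set.compl_Iic, h, measure_univ]
    · have : P.map (W 0) (Set.Iic y) = 0 := by
        rw [Measure.map_apply (hW 0) measurableSet_Iic, ← compl_compl (W 0 ⁻¹' _),
          prob_compl_eq_zero_iff₀ ((hW 0 measurableSet_Iic).compl.nullMeasurableSet),
          ← mem_ae_iff_prob_eq_one₀ ((hW 0 measurableSet_Iic).compl.nullMeasurableSet)]
        filter_upwards [hpos 0] with ω hω
        simp only [Set.mem_compl_iff, Set.mem_preimage, Set.mem_Iic, not_le]
        linarith
      simp [hk, hy, this]
  set p : ℕ → ℝ≥0∞ := fun n => P {ω | renewalEpoch W n ω ≤ x} with hp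
  -- The telescoping relation is kept in additive form to avoid truncated subtraction in `ℝ≥0∞`.
  have hstep (n : ℕ) : ∫⁻ v, k (x - v) ∂(P.map (renewalEpoch W n)) + p (n + 1) = p n := by
    have h1 := measure_Iic_sub_renewal hW hi hid MeasurableSet.univ n 1 x
    have h2 : renewalEpoch W 1 = W 0 := by ext ω; simp [renewalEpoch]
    simp only [Set.mem_univ, true_and, Measure.restrict_univ, h2] at h1
    simp only [hp]
    rw [h1, ← lintegral_add_left (by fun_prop)]
    simp_rw [hadd]
    have h3 : (fun v : ℝ => (Set.Ici (0 : ℝ)).indicator (1 : ℝ → ℝ≥0∞) (x - v))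
        = (Set.Iic x).indicator 1 := by
      ext v; simp [Set.indicator_apply]
    rw [h3, lintegral_indicator_one measurableSet_Iic,
      Measure.map_apply (measurable_renewalEpoch hW n) measurableSet_Iic]
    rfl
  have hsum (n : ℕ) : ∑ i ∈ Finset.range n, ∫⁻ v, k (x - v) ∂(P.map (renewalEpoch W i)) + p n
      = p 0 := by
    induction n with
    | zero => simp
    | succ n ih => rw [Finset.sum_range_succ, add_assoc, hstep, ih]
  have hlim := (ENNReal.tendsto_nat_tsum fun i =>
    ∫⁻ v, k (x - v) ∂(P.map (renewalEpoch W i))).add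
      (tendsto_measure_renewalEpoch_le hW hi hid hpos x)
  rw [lintegral_sum_measure]
  have hp0 : p 0 = (Set.Ici (0 : ℝ)).indicator 1 x := by
    by_cases hx : 0 ≤ x <;> simp [hp, renewalEpoch, hx]
  rw [← hp0, ← add_zero (∑' _, _)]
  refine tendsto_nhds_unique hlim ?_
  simp only [hp] at hsum ⊢
  simp_rw [hsum]
  exact tendsto_const_nhds

end Renewal

/-! ### The renewal measure of Mittag-Leffler waiting times -/

/-- `W` is a sequence of i.i.d. waiting times of Mittag-Leffler law. -/
structure IsMittagLefflerWaiting {Ω : Type*} [MeasurableSpace Ω] (β lam : ℝ) (W : ℕ → Ω → ℝ)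
    (P : Measure Ω) : Prop where
  measurable : ∀ k, Measurable (W k)
  indep : iIndepFun W P
  tail : ∀ k, ∀ t : ℝ, 0 ≤ t → P.real {ω | t < W k ω} = mittagLeffler β (-(lam * t ^ β))

theorem ENNReal.tsum_tsum_eq_diag_add_upper_add_lower (f : ℕ → ℕ → ℝ≥0∞) :
    ∑' i, ∑' j, f i j = ∑' i, f i i + ∑' i, ∑' m, f i (i + (m + 1))
      + ∑' j, ∑' m, f (j + (m + 1)) j := by
  have h1 (i : ℕ) : ∑' j, f i j
      = f i i + ∑' m, f i (i + (m + 1)) + ∑' j, if j < i then f i j else 0 := by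
    have h2 : ∑' j, f i j = ∑ j ∈ Finset.range i, f i j + ∑' m, f i (m + i) :=
      (ENNReal.summable.sum_add_tsum_nat_add' ..).symm
    have h3 : ∑' j, (if j < i then f i j else 0) = ∑ j ∈ Finset.range i, f i j := by
      rw [tsum_eq_sum (s := Finset.range i) fun j hj => by simp_all]
      exact Finset.sum_congr rfl fun j hj => by simp_all
    rw [h2, h3, tsum_eq_zero_add' ENNReal.summable, add_comm]
    simp [add_comm, add_left_comm]
  simp_rw [h1]
  rw [ENNReal.tsum_add, ENNReal.tsum_add]
  congr 1
  rw [ENNReal.tsum_comm]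
  refine tsum_congr fun j => ?_
  have h4 : ∑' i, (if j < i then f i j else 0)
      = ∑ i ∈ Finset.range (j + 1), (if j < i then f i j else 0)
        + ∑' m, (if j < m + (j + 1) then f (m + (j + 1)) j else 0) :=
    (ENNReal.summable.sum_add_tsum_nat_add' ..).symm
  rw [h4, Finset.sum_eq_zero fun i hi => by
    rw [if_neg]; have := Finset.mem_range.1 hi; omega, zero_add]
  refine tsum_congr fun m => ?_
  rw [if_pos (by omega)]
  congr 1; omega

namespace IsMittagLefflerWaiting

variable {Ω : Type*} [MeasurableSpace Ω] {P : Measure Ω} [IsProbabilityMeasure P]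
  {β lam : ℝ} {W : ℕ → Ω → ℝ}

theorem ae_pos (h : IsMittagLefflerWaiting β lam W P) (hβ : 0 < β) (k : ℕ) :
    ∀ᵐ ω ∂P, 0 < W k ω := by
  have h1 := h.tail k 0 le_rfl
  rw [Real.zero_rpow hβ.ne', mul_zero, neg_zero, mittagLeffler_zero] at h1
  have hm : MeasurableSet {ω | 0 < W k ω} := measurableSet_lt measurable_const (h.measurable k)
  exact (mem_ae_iff_prob_eq_one hm).2 (by
    rw [← ofReal_measureReal, h1, ENNReal.ofReal_one])

/-- The prescribed tail fixes the law on `[0, ∞)` only; almost sure positivity settles negative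
arguments. -/
theorem map_eq (h : IsMittagLefflerWaiting β lam W P) (hβ : 0 < β) (k : ℕ) :
    P.map (W k) = P.map (W 0) := by
  have hp (k : ℕ) := Measure.isProbabilityMeasure_map (μ := P) (h.measurable k).aemeasurable
  have := hp k
  have := hp 0
  have hIoi (x : ℝ) : P.map (W k) (Set.Ioi x) = P.map (W 0) (Set.Ioi x) := by
    rw [Measure.map_apply (h.measurable k) measurableSet_Ioi,
      Measure.map_apply (h.measurable 0) measurableSet_Ioi]
    rcases le_or_gt 0 x with hx | hx
    · have h1 := (h.tail k x hx).trans (h.tail 0 x hx).symm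
      exact (measureReal_eq_measureReal_iff ..).1 h1
    · have h2 (k : ℕ) : P (W k ⁻¹' Set.Ioi x) = 1 := by
        refine (mem_ae_iff_prob_eq_one (h.measurable k measurableSet_Ioi)).1 ?_
        filter_upwards [h.ae_pos hβ k] with ω hω
        exact hx.trans hω
      rw [h2, h2]
  refine Measure.ext_of_Iic _ _ fun x => ?_
  rw [← Set.compl_Ioi, prob_compl_eq_one_sub measurableSet_Ioi,
    prob_compl_eq_one_sub measurableSet_Ioi, hIoi]

theorem ae_strictMono_renewalEpoch (h : IsMittagLefflerWaiting β lam W P) (hβ : 0 < β) :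
    ∀ᵐ ω ∂P, StrictMono fun n => renewalEpoch W n ω := by
  filter_upwards [ae_all_iff.2 (h.ae_pos hβ)] with ω hω
  refine strictMono_nat_of_lt_succ fun n => ?_
  simp only [renewalEpoch, Finset.sum_range_succ]
  linarith [hω n]

theorem survival_eq (h : IsMittagLefflerWaiting β lam W P) (y : ℝ) :
    P.map (W 0) (Set.Ioi y) = ENNReal.ofReal (P.real {ω | y < W 0 ω}) := by
  rw [Measure.map_apply (h.measurable 0) measurableSet_Ioi, ofReal_measureReal]
  rfl

/-- For `x ≥ 0` the atom at `0` contributes the survival probability at `x` and the power measure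
contributes its complement to `1`. -/
theorem lintegral_survival_powerRenewalMeasure (h : IsMittagLefflerWaiting β lam W P)
    (hβ : 0 < β) (hlam : 0 < lam) (x : ℝ) :
    ∫⁻ v, (Set.Ici (0 : ℝ)).indicator (fun y => P.map (W 0) (Set.Ioi y)) (x - v)
        ∂(Measure.dirac 0 + powerRenewalMeasure β lam)
      = (Set.Ici (0 : ℝ)).indicator 1 x := by
  have hH : Antitone fun y => P.real {ω | y < W 0 ω} := fun a b hab =>
    measureReal_mono fun ω hω => lt_of_le_of_lt hab hω
  have hG : Measurable fun y => P.map (W 0) (Set.Ioi y) :=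
    Antitone.measurable fun a b hab => measure_mono (Set.Ioi_subset_Ioi hab)
  have h1 : (fun v => (Set.Ici (0 : ℝ)).indicator (fun y => P.map (W 0) (Set.Ioi y)) (x - v))
      = (Set.Iic x).indicator fun v => P.map (W 0) (Set.Ioi (x - v)) := by
    ext v; simp [Set.indicator_apply]
  have hG' : Measurable fun v => P.map (W 0) (Set.Ioi (x - v)) :=
    hG.comp (measurable_const.sub measurable_id)
  rw [lintegral_add_measure, lintegral_dirac, h1, lintegral_indicator measurableSet_Iic,
    setLIntegral_powerRenewalMeasure _ _ hG', sub_zero]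
  rcases le_or_gt 0 x with hx | hx
  · simp_rw [h.survival_eq]
    rw [lintegral_survival_mul_rpow hβ hlam hH (fun _ => measureReal_nonneg)
      (fun _ => measureReal_le_one) (h.tail 0) hx]
    simp only [Set.mem_Ici, hx, Set.indicator_of_mem, Pi.one_apply]
    have h1 : P.real {ω | x < W 0 ω} ≤ 1 := measureReal_le_one
    rw [← ENNReal.ofReal_add measureReal_nonneg (by linarith)]
    simp
  · simp [hx.not_ge, hx.le]

theorem sum_map_renewalEpoch_Iic (h : IsMittagLefflerWaiting β lam W P) (hβ : 0 < β)
    (hlam : 0 < lam) (t : ℝ) :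
    (Measure.sum fun n => P.map (renewalEpoch W (n + 1))) (Set.Iic t)
      = powerRenewalMeasure β lam (Set.Iic t) := by
  have (n : ℕ) := Measure.isProbabilityMeasure_map (μ := P)
    (measurable_renewalEpoch h.measurable n).aemeasurable
  have hkm : Measurable ((Set.Ici (0 : ℝ)).indicator fun y => P.map (W 0) (Set.Ioi y)) :=
    (Antitone.measurable fun a b hab => measure_mono (Set.Ioi_subset_Ioi hab)).indicator
      measurableSet_Ici
  have key := measure_Iic_eq_of_lintegral_sub_eq hkm
    (lintegral_survival_sum_map_renewalEpoch h.measurable h.indep (h.map_eq hβ) (h.ae_pos hβ))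
    (h.lintegral_survival_powerRenewalMeasure hβ hlam) t
  have h0 : P.map (renewalEpoch W 0) = Measure.dirac 0 := by
    have : renewalEpoch W 0 = fun _ => (0 : ℝ) := by ext ω; simp [renewalEpoch]
    rw [this, Measure.map_const, measure_univ, one_smul]
  -- The epoch of index `0` is the atom `δ₀` on both sides; being finite, it cancels.
  rw [Measure.sum_apply _ measurableSet_Iic, tsum_eq_zero_add' ENNReal.summable, h0,
    Measure.add_apply, ENNReal.add_right_inj (measure_ne_top _ _)] at key
  rw [Measure.sum_apply _ measurableSet_Iic, key]

theorem sum_map_renewalEpoch (h : IsMittagLefflerWaiting β lam W P) (hβ : 0 < β)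
    (hlam : 0 < lam) :
    (Measure.sum fun n => P.map (renewalEpoch W (n + 1))) = powerRenewalMeasure β lam := by
  have hfin (t : ℝ) : powerRenewalMeasure β lam (Set.Iic t) ≠ ∞ := by
    refine ne_top_of_le_ne_top ?_ (measure_mono (Set.Iic_subset_Iic.2 (le_max_left t 0)))
    rw [powerRenewalMeasure_Iic hβ hlam (le_max_right _ _)]
    exact ENNReal.ofReal_ne_top
  have hI := h.sum_map_renewalEpoch_Iic hβ hlam
  refine Measure.ext_of_Ioc' _ _ (fun a b _ => ?_) fun a b hab => ?_
  · refine ne_top_of_le_ne_top ?_ (measure_mono Set.Ioc_subset_Iic_self)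
    rw [hI]
    exact hfin b
  · have hd : Set.Ioc a b = Set.Iic b \ Set.Iic a := by ext; simp [and_comm]
    rw [hd, measure_sdiff (Set.Iic_subset_Iic.2 hab.le)
      measurableSet_Iic.nullMeasurableSet (by rw [hI]; exact hfin a),
      measure_sdiff (Set.Iic_subset_Iic.2 hab.le)
      measurableSet_Iic.nullMeasurableSet (hfin a), hI, hI]

theorem tsum_measure_renewalEpoch_le (h : IsMittagLefflerWaiting β lam W P) (hβ : 0 < β)
    (hlam : 0 < lam) {t : ℝ} (ht : 0 ≤ t) :
    ∑' n, P {ω | renewalEpoch W (n + 1) ω ≤ t}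
      = ENNReal.ofReal (lam / Real.Gamma (1 + β) * t ^ β) := by
  rw [← powerRenewalMeasure_Iic hβ hlam ht, ← h.sum_map_renewalEpoch hβ hlam,
    Measure.sum_apply _ measurableSet_Iic]
  refine tsum_congr fun n => ?_
  rw [Measure.map_apply (measurable_renewalEpoch h.measurable _) measurableSet_Iic]
  rfl

/-- After conditioning on the earlier epoch, summing over `m` turns the law of the increment into
the renewal measure, and summing over `i` does the same for the earlier epoch. -/
theorem tsum_tsum_measure_renewalEpoch_le_add (h : IsMittagLefflerWaiting β lam W P) (hβ : 0 < β)
    (hlam : 0 < lam) {s t : ℝ} (hs : 0 ≤ s) (hst : s ≤ t) :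
    ∑' i, ∑' m, P {ω | renewalEpoch W (i + 1) ω ≤ s ∧ renewalEpoch W (i + 1 + (m + 1)) ω ≤ t}
      = ENNReal.ofReal ((lam / Real.Gamma (1 + β)) ^ 2 * β * (t ^ (2 * β)
          * incompleteBeta β (1 + β) (s / t))) := by
  rw [← setLIntegral_powerRenewalMeasure_Iic_sub hβ hlam hs hst]
  have hm (n : ℕ) : Measurable fun u : ℝ => P.map (renewalEpoch W n) (Set.Iic (t - u)) :=
    Antitone.measurable fun a b hab => measure_mono (Set.Iic_subset_Iic.2 (by linarith))
  have h1 (i m : ℕ) := measure_Iic_sub_renewal h.measurable h.indep (h.map_eq hβ)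
    (measurableSet_Iic (a := s)) (i + 1) (m + 1) t
  simp only [Set.mem_Iic] at h1
  simp_rw [h1]
  have h2 (i : ℕ) : ∑' m, ∫⁻ u in Set.Iic s, P.map (renewalEpoch W (m + 1)) (Set.Iic (t - u))
        ∂(P.map (renewalEpoch W (i + 1)))
      = ∫⁻ u in Set.Iic s, powerRenewalMeasure β lam (Set.Iic (t - u))
        ∂(P.map (renewalEpoch W (i + 1))) := by
    rw [← lintegral_tsum fun m => (hm (m + 1)).aemeasurable]
    simp_rw [← h.sum_map_renewalEpoch hβ hlam, Measure.sum_apply _ measurableSet_Iic]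
  simp_rw [h2]
  conv_rhs => rw [← congrArg (fun μ : Measure ℝ => μ.restrict (Set.Iic s))
    (h.sum_map_renewalEpoch hβ hlam)]
  rw [Measure.restrict_sum _ measurableSet_Iic, lintegral_sum_measure]

/-- Diagonal, `i < j` and `i > j`. When `i > j`, the constraint at `s` on the later epoch implies
the one at `t` on the earlier epoch, so `t` is replaced by `s`. Writing `s / s` instead of `1`
avoids a separate case `s = 0`. -/
theorem tsum_tsum_measure_renewalEpoch_le (h : IsMittagLefflerWaiting β lam W P) (hβ : 0 < β)
    (hlam : 0 < lam) {s t : ℝ} (hs : 0 ≤ s) (hst : s ≤ t) :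
    ∑' i, ∑' j, P {ω | renewalEpoch W (i + 1) ω ≤ s ∧ renewalEpoch W (j + 1) ω ≤ t}
      = ENNReal.ofReal (lam / Real.Gamma (1 + β) * s ^ β)
        + ENNReal.ofReal ((lam / Real.Gamma (1 + β)) ^ 2 * β * (t ^ (2 * β)
          * incompleteBeta β (1 + β) (s / t)))
        + ENNReal.ofReal ((lam / Real.Gamma (1 + β)) ^ 2 * β * (s ^ (2 * β)
          * incompleteBeta β (1 + β) (s / s))) := by
  have hmono := h.ae_strictMono_renewalEpoch hβ
  rw [ENNReal.tsum_tsum_eq_diag_add_upper_add_lower,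
    ← h.tsum_tsum_measure_renewalEpoch_le_add hβ hlam hs hst,
    ← h.tsum_tsum_measure_renewalEpoch_le_add hβ hlam hs le_rfl,
    ← h.tsum_measure_renewalEpoch_le hβ hlam hs]
  congr 1
  · congr 1
    · refine tsum_congr fun i => ?_
      congr 1; ext ω
      exact ⟨fun h => h.1, fun h => ⟨h, le_trans h hst⟩⟩
    · refine tsum_congr fun i => tsum_congr fun m => ?_
      rw [add_right_comm i]
  · refine tsum_congr fun j => tsum_congr fun m => measure_congr ?_
    filter_upwards [hmono] with ω hω
    have h1 : renewalEpoch W (j + 1) ω ≤ renewalEpoch W (j + 1 + (m + 1)) ω :=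
      hω.monotone (by omega)
    rw [eq_iff_iff]
    change _ ∧ _ ↔ _ ∧ _
    rw [add_right_comm j]
    constructor
    · rintro ⟨h2, -⟩
      exact ⟨h1.trans h2, h2⟩
    · rintro ⟨h2, h3⟩
      exact ⟨h3, h2.trans hst⟩

/-- Borel–Cantelli at each integer level, the probabilities being summable by the renewal measure.
-/
theorem ae_exists_lt_renewalEpoch (h : IsMittagLefflerWaiting β lam W P) (hβ : 0 < β)
    (hlam : 0 < lam) :
    ∀ᵐ ω ∂P, ∀ t : ℝ, ∃ n, t < renewalEpoch W n ω := by
  have h1 (N : ℕ) : ∀ᵐ ω ∂P, ∀ᶠ n in atTop, ¬ renewalEpoch W (n + 1) ω ≤ N := by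
    refine ae_eventually_notMem (s := fun n => {ω | renewalEpoch W (n + 1) ω ≤ N}) ?_
    rw [h.tsum_measure_renewalEpoch_le hβ hlam N.cast_nonneg]
    exact ENNReal.ofReal_ne_top
  filter_upwards [ae_all_iff.2 h1] with ω hω t
  obtain ⟨N, hN⟩ := exists_nat_ge t
  obtain ⟨n, hn⟩ := (hω N).exists
  exact ⟨n + 1, hN.trans_lt (not_le.1 hn)⟩

end IsMittagLefflerWaiting

/-! ### The counting function and its jointly measurable version -/

/-- The unboundedness hypothesis is essential to the supremum: `sSup` of an unbounded set of
naturals is `0`. -/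
theorem le_renewalCount_iff {w : ℕ → ℝ} (hmono : Monotone fun n => ∑ i ∈ Finset.range n, w i)
    {t : ℝ} (ht : 0 ≤ t) (hub : ∃ n, t < ∑ i ∈ Finset.range n, w i) (n : ℕ) :
    n ≤ renewalCount w t ↔ ∑ i ∈ Finset.range n, w i ≤ t := by
  obtain ⟨N, hN⟩ := hub
  have hbdd : BddAbove {n : ℕ | ∑ i ∈ Finset.range n, w i ≤ t} := by
    refine ⟨N, fun m hm => ?_⟩
    by_contra hc
    exact absurd ((hmono (not_le.1 hc).le).trans hm) (not_le.2 hN)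
  have hne : {n : ℕ | ∑ i ∈ Finset.range n, w i ≤ t}.Nonempty := ⟨0, by simpa using ht⟩
  exact ⟨fun h => (hmono h).trans (Nat.sSup_mem hne hbdd), fun h => le_csSup hbdd h⟩

theorem renewalCount_eq_tsum {w : ℕ → ℝ} (hmono : Monotone fun n => ∑ i ∈ Finset.range n, w i)
    {t : ℝ} (ht : 0 ≤ t) (hub : ∃ n, t < ∑ i ∈ Finset.range n, w i) :
    (renewalCount w t : ℝ≥0∞)
      = ∑' n, if ∑ i ∈ Finset.range (n + 1), w i ≤ t then 1 else 0 := by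
  simp_rw [← le_renewalCount_iff hmono ht hub]
  rw [tsum_eq_sum (s := Finset.range (renewalCount w t)) fun n hn => by simp_all]
  rw [Finset.sum_congr rfl fun n hn => if_pos (by simpa using hn)]
  simp

/-- The value at `a` of the right-continuous regularization of a nondecreasing `f : ℝ≥0 → ℕ`. -/
noncomputable def rightRegularization (f : ℝ≥0 → ℕ) (a : ℝ≥0) : ℕ :=
  sInf {m | ∃ k, a < TopologicalSpace.denseSeq ℝ≥0 k ∧ f (TopologicalSpace.denseSeq ℝ≥0 k) = m}

theorem rightRegularization_le_iff (f : ℝ≥0 → ℕ) (a : ℝ≥0) (n : ℕ) :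
    rightRegularization f a ≤ n ↔
      ∃ k, a < TopologicalSpace.denseSeq ℝ≥0 k ∧ f (TopologicalSpace.denseSeq ℝ≥0 k) ≤ n := by
  have hne : {m | ∃ k, a < TopologicalSpace.denseSeq ℝ≥0 k ∧
      f (TopologicalSpace.denseSeq ℝ≥0 k) = m}.Nonempty := by
    obtain ⟨_, ⟨k, rfl⟩, hk⟩ := (TopologicalSpace.denseRange_denseSeq ℝ≥0).exists_between
      (lt_add_one a)
    exact ⟨_, k, hk.1, rfl⟩
  constructor
  · intro h
    obtain ⟨k, hk, hk'⟩ := Nat.sInf_mem hne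
    exact ⟨k, hk, hk'.trans_le h⟩
  · rintro ⟨k, hk, hk'⟩
    exact (Nat.sInf_le (by exact ⟨k, hk, rfl⟩)).trans hk'

/-- Sublevel sets are countable unions of rectangles. Evaluating a path at a random time needs this
joint measurability, whereas `N` is only assumed measurable at each fixed time. -/
theorem measurable_rightRegularization :
    Measurable fun p : (ℝ≥0 → ℕ) × ℝ≥0 => rightRegularization p.1 p.2 := by
  refine measurable_of_Iic fun n => ?_
  have : (fun p : (ℝ≥0 → ℕ) × ℝ≥0 => rightRegularization p.1 p.2) ⁻¹' Set.Iic n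
      = ⋃ k, {p | p.2 < TopologicalSpace.denseSeq ℝ≥0 k} ∩
        {p | p.1 (TopologicalSpace.denseSeq ℝ≥0 k) ≤ n} := by
    ext p
    simp [rightRegularization_le_iff]
  rw [this]
  exact MeasurableSet.iUnion fun k => (measurableSet_lt measurable_snd measurable_const).inter
    (measurableSet_le ((measurable_pi_apply _).comp measurable_fst) measurable_const)

theorem rightRegularization_eq {f : ℝ≥0 → ℕ} (hf : Monotone f)
    (hc : ∀ a, ∃ b, a < b ∧ ∀ c, c < b → f c ≤ f a) (a : ℝ≥0) :
    rightRegularization f a = f a := by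
  refine le_antisymm ?_ ?_
  · obtain ⟨b, hab, hb⟩ := hc a
    obtain ⟨_, ⟨k, rfl⟩, hk⟩ := (TopologicalSpace.denseRange_denseSeq ℝ≥0).exists_between hab
    exact (rightRegularization_le_iff f a _).2 ⟨k, hk.1, hb _ hk.2⟩
  · obtain ⟨k, hk, hk'⟩ := (rightRegularization_le_iff f a _).1 le_rfl
    exact (hf hk.le).trans hk'

/-! ### Moments of the fractional Poisson process and conditioning on the clock -/

namespace IsFractionalPoissonProcess

variable {Ω : Type*} [MeasurableSpace Ω] {P : Measure Ω} [IsProbabilityMeasure P]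
  {β lam : ℝ} {N : ℝ≥0 → Ω → ℕ}

theorem exists_waiting (h : IsFractionalPoissonProcess β lam N P) (hβ : 0 < β) (hlam : 0 < lam) :
    ∃ W, IsMittagLefflerWaiting β lam W P ∧
      ∀ᵐ ω ∂P, (∀ t : ℝ≥0, ∀ n, n ≤ N t ω ↔ renewalEpoch W n ω ≤ t) ∧
        ∀ t : ℝ≥0, (N t ω : ℝ≥0∞)
          = ∑' n, {ω | renewalEpoch W (n + 1) ω ≤ t}.indicator 1 ω := by
  obtain ⟨W, hm, hi, htail, hN⟩ := h.renewal
  have hW : IsMittagLefflerWaiting β lam W P := ⟨hm, hi, htail⟩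
  refine ⟨W, hW, ?_⟩
  filter_upwards [hN, hW.ae_strictMono_renewalEpoch hβ, hW.ae_exists_lt_renewalEpoch hβ hlam]
    with ω h1 h2 h3
  refine ⟨fun t n => ?_, fun t => ?_⟩
  · rw [h1]
    exact le_renewalCount_iff h2.monotone t.2 (h3 t) n
  · rw [h1, renewalCount_eq_tsum (w := fun k => W k ω) h2.monotone t.coe_nonneg (h3 t)]
    refine tsum_congr fun n => ?_
    simp [Set.indicator_apply, renewalEpoch]

theorem ae_rightRegularization_eq (h : IsFractionalPoissonProcess β lam N P) (hβ : 0 < β)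
    (hlam : 0 < lam) :
    ∀ᵐ ω ∂P, ∀ a, rightRegularization (fun t => N t ω) a = N a ω := by
  obtain ⟨W, hW, hN⟩ := h.exists_waiting hβ hlam
  filter_upwards [hN] with ω hNω
  have hω := hNω.1
  refine rightRegularization_eq (fun s t hst => (hω t _).2 (((hω s _).1 le_rfl).trans hst))
    fun a => ?_
  have h1 : (a : ℝ) < renewalEpoch W (N a ω + 1) ω :=
    not_le.1 fun hc => absurd ((hω a _).2 hc) (by omega)
  -- The path does not exceed `N a ω` before the next renewal epoch.
  refine ⟨(renewalEpoch W (N a ω + 1) ω).toNNReal, (Real.lt_toNNReal_iff_coe_lt).2 h1,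
    fun c hc => ?_⟩
  by_contra hcon
  have h2 := (hω c (N a ω + 1)).1 (by omega)
  exact absurd ((Real.lt_toNNReal_iff_coe_lt).1 hc) (not_lt.2 h2)

theorem lintegral_eq (h : IsFractionalPoissonProcess β lam N P) (hβ : 0 < β) (hlam : 0 < lam)
    (t : ℝ≥0) :
    ∫⁻ ω, (N t ω : ℝ≥0∞) ∂P = ENNReal.ofReal (lam / Real.Gamma (1 + β) * (t : ℝ) ^ β) := by
  obtain ⟨W, hW, hN⟩ := h.exists_waiting hβ hlam
  have hms (n : ℕ) : MeasurableSet {ω | renewalEpoch W (n + 1) ω ≤ t} :=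
    measurableSet_le (measurable_renewalEpoch hW.measurable _) measurable_const
  rw [lintegral_congr_ae (hN.mono fun ω hω => hω.2 t), lintegral_tsum fun n =>
    (measurable_one.indicator (hms n)).aemeasurable]
  simp_rw [lintegral_indicator_one (hms _)]
  exact hW.tsum_measure_renewalEpoch_le hβ hlam t.2

theorem lintegral_mul_eq (h : IsFractionalPoissonProcess β lam N P) (hβ : 0 < β) (hlam : 0 < lam)
    {s t : ℝ≥0} (hst : s ≤ t) :
    ∫⁻ ω, (N s ω : ℝ≥0∞) * N t ω ∂P
      = ENNReal.ofReal (lam / Real.Gamma (1 + β) * (s : ℝ) ^ β)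
        + ENNReal.ofReal ((lam / Real.Gamma (1 + β)) ^ 2 * β * ((t : ℝ) ^ (2 * β)
          * incompleteBeta β (1 + β) (s / t)))
        + ENNReal.ofReal ((lam / Real.Gamma (1 + β)) ^ 2 * β * ((s : ℝ) ^ (2 * β)
          * incompleteBeta β (1 + β) (s / s))) := by
  obtain ⟨W, hW, hN⟩ := h.exists_waiting hβ hlam
  have hms (r : ℝ) (n : ℕ) : MeasurableSet {ω | renewalEpoch W (n + 1) ω ≤ r} :=
    measurableSet_le (measurable_renewalEpoch hW.measurable _) measurable_const
  rw [← hW.tsum_tsum_measure_renewalEpoch_le hβ hlam s.coe_nonneg (NNReal.coe_le_coe.2 hst)]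
  have h1 : ∀ᵐ ω ∂P, (N s ω : ℝ≥0∞) * N t ω
      = ∑' i, ∑' j, ({ω | renewalEpoch W (i + 1) ω ≤ s}
        ∩ {ω | renewalEpoch W (j + 1) ω ≤ t}).indicator 1 ω := by
    filter_upwards [hN] with ω hω
    rw [hω.2, hω.2, ← ENNReal.tsum_mul_right]
    simp_rw [← ENNReal.tsum_mul_left, Set.inter_indicator_one, Pi.mul_apply]
  rw [lintegral_congr_ae h1, lintegral_tsum fun i => (Measurable.tsum fun j =>
    measurable_one.indicator ((hms s i).inter (hms t j))).aemeasurable]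
  refine tsum_congr fun i => ?_
  rw [lintegral_tsum fun j =>
    (measurable_one.indicator ((hms s i).inter (hms t j))).aemeasurable]
  refine tsum_congr fun j => ?_
  rw [lintegral_indicator_one ((hms s i).inter (hms t j))]
  rfl

variable {M : ℝ≥0 → Ω → ℝ≥0}

theorem aemeasurable_timeChange (h : IsFractionalPoissonProcess β lam N P) (hβ : 0 < β)
    (hlam : 0 < lam) (hM : ∀ t, Measurable (M t)) (t : ℝ≥0) :
    AEMeasurable (timeChange N M t) P := by
  refine ⟨fun ω => rightRegularization (fun r => N r ω) (M t ω),
    measurable_rightRegularization.comp ((measurable_pi_lambda _ h.measurable).prodMk (hM t)), ?_⟩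
  filter_upwards [h.ae_rightRegularization_eq hβ hlam] with ω hω
  rw [hω]
  rfl

/-- Replace `N` by its regularization, a measurable functional of the two paths, and apply Tonelli
to the product law. The null set on which the two differ does not depend on time, so random times
are harmless. -/
theorem lintegral_timeChange (h : IsFractionalPoissonProcess β lam N P) (hβ : 0 < β)
    (hlam : 0 < lam) (hM : ∀ t, Measurable (M t))
    (hNM : IndepFun (fun ω t => N t ω) (fun ω t => M t ω) P) (φ : ℕ → ℕ → ℝ≥0∞) (s t : ℝ≥0) :
    ∫⁻ ω, φ (timeChange N M s ω) (timeChange N M t ω) ∂P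
      = ∫⁻ ω, ∫⁻ ω', φ (N (M s ω) ω') (N (M t ω) ω') ∂P ∂P := by
  have hX : Measurable fun ω t => N t ω := measurable_pi_lambda _ h.measurable
  have hY : Measurable fun ω t => M t ω := measurable_pi_lambda _ hM
  set Φ : (ℝ≥0 → ℕ) × (ℝ≥0 → ℝ≥0) → ℝ≥0∞ := fun p =>
    φ (rightRegularization p.1 (p.2 s)) (rightRegularization p.1 (p.2 t)) with hΦ
  have hR (r : ℝ≥0) : Measurable fun p : (ℝ≥0 → ℕ) × (ℝ≥0 → ℝ≥0) =>
      rightRegularization p.1 (p.2 r) :=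
    measurable_rightRegularization.comp
      (measurable_fst.prodMk ((measurable_pi_apply r).comp measurable_snd))
  have hφ : Measurable fun p : ℕ × ℕ => φ p.1 p.2 := measurable_of_countable _
  have hΦm : Measurable Φ := hφ.comp ((hR s).prodMk (hR t))
  have hae := h.ae_rightRegularization_eq hβ hlam
  have h1 : ∫⁻ ω, φ (timeChange N M s ω) (timeChange N M t ω) ∂P
      = ∫⁻ ω, Φ (fun t => N t ω, fun t => M t ω) ∂P := by
    refine lintegral_congr_ae ?_
    filter_upwards [hae] with ω hω
    simp only [hΦ, hω]
    rfl
  rw [h1, ← lintegral_map hΦm (hX.prodMk hY),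
    (indepFun_iff_map_prod_eq_prod_map_map hX.aemeasurable hY.aemeasurable).1 hNM]
  have := Measure.isProbabilityMeasure_map (μ := P) hX.aemeasurable
  have := Measure.isProbabilityMeasure_map (μ := P) hY.aemeasurable
  rw [lintegral_prod_symm' _ hΦm, lintegral_map hΦm.lintegral_prod_left' hY]
  refine lintegral_congr fun ω => ?_
  have hsec : Measurable fun f : ℝ≥0 → ℕ => Φ (f, fun r => M r ω) :=
    hΦm.comp measurable_prodMk_right
  rw [lintegral_map hsec hX]
  refine lintegral_congr_ae ?_
  filter_upwards [hae] with ω' hω'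
  simp only [hΦ, hω']

end IsFractionalPoissonProcess

/-! ### Fractional moments of the subordinator -/

/-- Write `1 - e^(-ux)` as the integral of `x e^(-xy)` over `0 < y < u` and exchange: the
`u`-integral over `(y, ∞)` is `y^(-p)/p`, and a gamma integral remains. -/
theorem lintegral_one_sub_exp_mul_rpow {p : ℝ} (hp0 : 0 < p) (hp1 : p < 1) {x : ℝ} (hx : 0 ≤ x) :
    ∫⁻ u in Set.Ioi (0 : ℝ), ENNReal.ofReal ((1 - Real.exp (-(u * x))) * u ^ (-p - 1))
      = ENNReal.ofReal (x ^ p * (Real.Gamma (1 - p) / p)) := by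
  rcases hx.eq_or_lt with rfl | hx
  · simp [Real.zero_rpow hp0.ne']
  have hinner (u : ℝ) (hu : u ∈ Set.Ioi (0 : ℝ)) :
      ENNReal.ofReal ((1 - Real.exp (-(u * x))) * u ^ (-p - 1))
        = ∫⁻ y in Set.Ioi (0 : ℝ), (Set.Ioi y).indicator
          (fun u => ENNReal.ofReal (x * Real.exp (-(x * y)))
            * ENNReal.ofReal (u ^ (-p - 1))) u := by
    have h1 : (fun y => (Set.Ioi y).indicator (fun u => ENNReal.ofReal (x * Real.exp (-(x * y)))
          * ENNReal.ofReal (u ^ (-p - 1))) u)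
        = (Set.Iio u).indicator fun y => ENNReal.ofReal (x * Real.exp (-(x * y)))
          * ENNReal.ofReal (u ^ (-p - 1)) := by
      ext y; simp [Set.indicator_apply]
    have h2 : ∫ y in (0 : ℝ)..u, x * Real.exp (-(x * y)) = 1 - Real.exp (-(u * x)) := by
      rw [intervalIntegral.integral_eq_sub_of_hasDerivAt
        (f := fun y => - Real.exp (-(x * y)))]
      · rw [mul_zero, neg_zero, Real.exp_zero, mul_comm]; ring
      · intro y _
        have h : HasDerivAt (fun y => -Real.exp (-(x * y)))
            (-(Real.exp (-(x * y)) * -(x * 1))) y :=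
          (((hasDerivAt_id y).const_mul x).neg.exp).neg
        exact h.congr_deriv (by ring)
      · exact Continuous.intervalIntegrable (by fun_prop) _ _
    rw [h1, lintegral_indicator measurableSet_Iio, Measure.restrict_restrict measurableSet_Iio,
      Set.inter_comm, Set.Ioi_inter_Iio, lintegral_mul_const _ (by fun_prop), mul_comm (1 - _),
      ENNReal.ofReal_mul (Real.rpow_nonneg (le_of_lt hu) _), mul_comm (ENNReal.ofReal _)]
    congr 1
    rw [← h2, intervalIntegral.integral_of_le (le_of_lt hu), integral_Ioc_eq_integral_Ioo,
      ofReal_integral_eq_lintegral_ofReal]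
    · exact (Continuous.integrableOn_Icc (by fun_prop)).mono_set Set.Ioo_subset_Icc_self
    · exact ae_of_all _ fun y => by simp only [Pi.zero_apply]; positivity
  rw [setLIntegral_congr_fun measurableSet_Ioi hinner, lintegral_lintegral_swap]
  · have houter (y : ℝ) (hy : y ∈ Set.Ioi (0 : ℝ)) :
        ∫⁻ u in Set.Ioi (0 : ℝ), (Set.Ioi y).indicator
          (fun u => ENNReal.ofReal (x * Real.exp (-(x * y)))
            * ENNReal.ofReal (u ^ (-p - 1))) u
        = ENNReal.ofReal (x / p * (y ^ (1 - p - 1) * Real.exp (-(x * y)))) := by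
      have hy' : (0 : ℝ) < y := hy
      rw [lintegral_indicator measurableSet_Ioi, Measure.restrict_restrict measurableSet_Ioi,
        Set.inter_eq_left.2 (Set.Ioi_subset_Ioi hy'.le), lintegral_const_mul _ (by fun_prop),
        ← ofReal_integral_eq_lintegral_ofReal
          (integrableOn_Ioi_rpow_of_lt (by linarith) hy'), integral_Ioi_rpow_of_lt (by linarith) hy',
        ← ENNReal.ofReal_mul (by positivity)]
      · congr 1
        have h1 : -p - 1 + 1 = -p := by ring
        have h2 : 1 - p - 1 = -p := by ring
        rw [h1, h2]
        field_simp
      · filter_upwards [self_mem_ae_restrict measurableSet_Ioi] with u hu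
        exact Real.rpow_nonneg (hy'.trans hu).le _
    have hI := Real.integral_rpow_mul_exp_neg_mul_Ioi (a := 1 - p) (r := x) (by linarith) hx
    rw [setLIntegral_congr_fun measurableSet_Ioi houter, ← ofReal_integral_eq_lintegral_ofReal]
    · rw [integral_const_mul, hI]
      congr 1
      rw [one_div, Real.inv_rpow hx.le, Real.rpow_sub hx, Real.rpow_one]
      have := (Real.rpow_pos_of_pos hx p).ne'
      field_simp
    · refine Integrable.const_mul ?_ _
      -- A non-integrable function has Bochner integral `0`, so the positive gamma value already
      -- proves integrability.
      refine Integrable.of_integral_ne_zero ?_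
      rw [hI]
      have := Real.Gamma_pos_of_pos (show 0 < 1 - p by linarith)
      positivity
    · filter_upwards [self_mem_ae_restrict measurableSet_Ioi] with y hy
      have := Real.rpow_nonneg (le_of_lt hy) (1 - p - 1)
      simp only [Pi.zero_apply]
      positivity
  · have : Function.uncurry (fun u y : ℝ => (Set.Ioi y).indicator
        (fun u => ENNReal.ofReal (x * Real.exp (-(x * y)))
            * ENNReal.ofReal (u ^ (-p - 1))) u)
        = {q : ℝ × ℝ | q.2 < q.1}.indicator fun q => ENNReal.ofReal (x * Real.exp (-(x * q.2)))
            * ENNReal.ofReal (q.1 ^ (-p - 1)) := by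
      ext ⟨u, y⟩; simp [Function.uncurry, Set.indicator_apply]
    rw [this]
    exact (Measurable.indicator (by fun_prop)
      (measurableSet_lt measurable_snd measurable_fst)).aemeasurable

theorem one_sub_exp_mul_rpow_nonneg {c u : ℝ} (hc : 0 ≤ c) (r : ℝ) (hu : 0 ≤ u) :
    0 ≤ (1 - Real.exp (-c)) * u ^ r :=
  mul_nonneg (by linarith [Real.exp_le_one_iff.2 (neg_nonpos.2 hc)]) (Real.rpow_nonneg hu _)

theorem integrableOn_one_sub_exp_mul_rpow {p : ℝ} (hp0 : 0 < p) (hp1 : p < 1) {x : ℝ}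
    (hx : 0 ≤ x) :
    IntegrableOn (fun u : ℝ => (1 - Real.exp (-(u * x))) * u ^ (-p - 1)) (Set.Ioi 0) := by
  refine (lintegral_ofReal_ne_top_iff_integrable (by fun_prop) ?_).1 ?_
  · filter_upwards [self_mem_ae_restrict measurableSet_Ioi] with u hu
    exact one_sub_exp_mul_rpow_nonneg (mul_nonneg (le_of_lt hu) hx) _ (le_of_lt hu)
  · rw [lintegral_one_sub_exp_mul_rpow hp0 hp1 hx]
    exact ENNReal.ofReal_ne_top

theorem integral_one_sub_exp_mul_rpow {p : ℝ} (hp0 : 0 < p) (hp1 : p < 1) {x : ℝ} (hx : 0 ≤ x) :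
    ∫ u in Set.Ioi (0 : ℝ), (1 - Real.exp (-(u * x))) * u ^ (-p - 1)
      = x ^ p * (Real.Gamma (1 - p) / p) := by
  have hΓ := Real.Gamma_pos_of_pos (show 0 < 1 - p by linarith)
  have h := lintegral_one_sub_exp_mul_rpow hp0 hp1 hx
  rw [← ofReal_integral_eq_lintegral_ofReal (integrableOn_one_sub_exp_mul_rpow hp0 hp1 hx)] at h
  · refine (ENNReal.ofReal_eq_ofReal_iff (setIntegral_nonneg measurableSet_Ioi fun u hu => ?_)
      (by positivity)).1 h
    exact one_sub_exp_mul_rpow_nonneg (mul_nonneg (le_of_lt hu) hx) _ (le_of_lt hu)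
  · filter_upwards [self_mem_ae_restrict measurableSet_Ioi] with u hu
    exact one_sub_exp_mul_rpow_nonneg (mul_nonneg (le_of_lt hu) hx) _ (le_of_lt hu)

/-- The substitution `w = u ^ α`, with its Jacobian, turns order `p` into order `p / α`; below, `p <
α` brings this into `(0, 1)`. -/
theorem one_sub_exp_rpow_mul_rpow_eq {α p c : ℝ} (hα : 0 < α) {u : ℝ} (hu : u ∈ Set.Ioi (0 : ℝ)) :
    (α * u ^ (α - 1)) • ((1 - Real.exp (-(u ^ α * c))) * (u ^ α) ^ (-(p / α) - 1))
      = α * ((1 - Real.exp (-(c * u ^ α))) * u ^ (-p - 1)) := by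
  have hu' : (0 : ℝ) < u := hu
  have h1 : u ^ (-p - 1) = u ^ (α - 1) * (u ^ α) ^ (-(p / α) - 1) := by
    rw [← Real.rpow_mul hu'.le, ← Real.rpow_add hu']
    congr 1; field_simp; ring
  rw [h1, smul_eq_mul, mul_comm c]; ring

theorem integrableOn_one_sub_exp_rpow_mul_rpow {α p c : ℝ} (hp0 : 0 < p) (hpα : p < α)
    (hc : 0 ≤ c) :
    IntegrableOn (fun u : ℝ => (1 - Real.exp (-(c * u ^ α))) * u ^ (-p - 1)) (Set.Ioi 0) := by
  have hα : 0 < α := hp0.trans hpα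
  have h := (integrableOn_Ioi_comp_rpow_iff
    (fun w => (1 - Real.exp (-(w * c))) * w ^ (-(p / α) - 1)) hα.ne').2
    (integrableOn_one_sub_exp_mul_rpow (div_pos hp0 hα) ((div_lt_one hα).2 hpα) hc)
  rw [abs_of_pos hα, integrableOn_congr_fun (fun u hu => one_sub_exp_rpow_mul_rpow_eq hα hu)
    measurableSet_Ioi] at h
  refine (h.const_mul α⁻¹).congr (ae_of_all _ fun u => ?_)
  exact inv_mul_cancel_left₀ hα.ne' _

theorem integral_one_sub_exp_rpow_mul_rpow {α p c : ℝ} (hp0 : 0 < p) (hpα : p < α)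
    (hc : 0 ≤ c) :
    ∫ u in Set.Ioi (0 : ℝ), (1 - Real.exp (-(c * u ^ α))) * u ^ (-p - 1)
      = c ^ (p / α) * (Real.Gamma (1 - p / α) / p) := by
  have hα : 0 < α := hp0.trans hpα
  have h := integral_comp_rpow_Ioi_of_pos (p := α)
    (g := fun w => (1 - Real.exp (-(w * c))) * w ^ (-(p / α) - 1)) hα
  rw [integral_one_sub_exp_mul_rpow (div_pos hp0 hα) ((div_lt_one hα).2 hpα) hc,
    setIntegral_congr_fun measurableSet_Ioi fun u hu => one_sub_exp_rpow_mul_rpow_eq hα hu,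
    integral_const_mul] at h
  field_simp at h ⊢
  linarith

/-- This is `log (1 + x/μ) ≤ x/μ`. It provides the majorant both for finiteness of moments and for
the limit at large times. -/
theorem exp_neg_mul_div_le_div_add_rpow {μ r x : ℝ} (hμ : 0 < μ) (hr : 0 ≤ r) (hx : 0 ≤ x) :
    Real.exp (-(r * x / μ)) ≤ (μ / (μ + x)) ^ r := by
  have h1 : 0 < μ / (μ + x) := by positivity
  rw [Real.rpow_def_of_pos h1, Real.exp_le_exp]
  have h2 : μ / (μ + x) = (1 + x / μ)⁻¹ := by field_simp
  have h3 := Real.log_le_sub_one_of_pos (show 0 < 1 + x / μ by positivity)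
  rw [h2, Real.log_inv]
  have h4 : Real.log (1 + x / μ) * r ≤ x / μ * r := by gcongr; linarith
  have h5 : r * x / μ = x / μ * r := by ring
  linarith

theorem div_add_rpow_le_one {μ r x : ℝ} (hμ : 0 < μ) (hr : 0 ≤ r) (hx : 0 ≤ x) :
    (μ / (μ + x)) ^ r ≤ 1 :=
  Real.rpow_le_one (by positivity) ((div_le_one (by positivity)).2 (by linarith)) hr

theorem norm_one_sub_div_add_rpow_mul_rpow_le {μ r x u q : ℝ} (hμ : 0 < μ) (hr : 0 ≤ r)
    (hx : 0 ≤ x) (hu : 0 ≤ u) :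
    ‖(1 - (μ / (μ + x)) ^ r) * u ^ q‖ ≤ (1 - Real.exp (-(r * x / μ))) * u ^ q := by
  have h1 := div_add_rpow_le_one hμ hr hx
  have h2 := exp_neg_mul_div_le_div_add_rpow hμ hr hx
  have h3 := Real.rpow_nonneg hu q
  rw [Real.norm_of_nonneg (mul_nonneg (by linarith) h3)]
  gcongr

theorem integrableOn_one_sub_div_add_rpow_mul_rpow {α p μ r : ℝ} (hp0 : 0 < p) (hpα : p < α)
    (hμ : 0 < μ) (hr : 0 ≤ r) :
    IntegrableOn (fun u : ℝ => (1 - (μ / (μ + u ^ α)) ^ r) * u ^ (-p - 1)) (Set.Ioi 0) := by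
  refine (integrableOn_one_sub_exp_rpow_mul_rpow hp0 hpα (c := r / μ) (by positivity)).mono'
    (by fun_prop) ?_
  filter_upwards [self_mem_ae_restrict measurableSet_Ioi] with u hu
  have h := norm_one_sub_div_add_rpow_mul_rpow_le (q := -p - 1) hμ hr
    (Real.rpow_nonneg (le_of_lt hu) α) (le_of_lt hu)
  rwa [mul_div_right_comm] at h

theorem integral_one_sub_div_add_rpow_mul_rpow_scaled {α p μ r : ℝ} (hα : 0 < α) (hr : 0 < r) :
    ∫ u in Set.Ioi (0 : ℝ), (1 - (μ / (μ + u ^ α)) ^ r) * u ^ (-p - 1)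
      = r ^ (p / α)
        * ∫ v in Set.Ioi (0 : ℝ), (1 - (μ / (μ + v ^ α / r)) ^ r) * v ^ (-p - 1) := by
  -- The substitution is `u = r ^ (-1/α) v`, for which `u ^ α = v ^ α / r`.
  have hb : 0 < r ^ (-α⁻¹) := Real.rpow_pos_of_pos hr _
  have h := integral_comp_mul_left_Ioi
    (fun u : ℝ => (1 - (μ / (μ + u ^ α)) ^ r) * u ^ (-p - 1)) 0 hb
  rw [mul_zero] at h
  have h1 : ∀ v ∈ Set.Ioi (0 : ℝ), (1 - (μ / (μ + (r ^ (-α⁻¹) * v) ^ α)) ^ r)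
        * (r ^ (-α⁻¹) * v) ^ (-p - 1)
      = (r ^ (-α⁻¹))⁻¹ * r ^ (p / α)
        * ((1 - (μ / (μ + v ^ α / r)) ^ r) * v ^ (-p - 1)) := fun v hv => by
    rw [Real.mul_rpow hb.le (le_of_lt hv), Real.mul_rpow hb.le (le_of_lt hv),
      ← Real.rpow_mul hr.le, ← Real.rpow_mul hr.le, ← Real.rpow_neg hr.le, ← Real.rpow_add hr]
    have h2 : -α⁻¹ * α = -1 := by field_simp
    have h3 : -α⁻¹ * (-p - 1) = - -α⁻¹ + p / α := by field_simp; ring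
    rw [h2, h3, Real.rpow_neg_one]
    ring_nf
  rw [setIntegral_congr_fun measurableSet_Ioi h1, integral_const_mul, mul_assoc, smul_eq_mul] at h
  exact (mul_left_cancel₀ (inv_pos.2 hb).ne' h).symm

theorem tendsto_div_add_div_rpow {μ : ℝ} (hμ : 0 < μ) (x : ℝ) :
    Tendsto (fun r : ℝ => (μ / (μ + x / r)) ^ r) atTop (𝓝 (Real.exp (-(1 / μ * x)))) := by
  have h := (Real.tendsto_one_add_div_rpow_exp (1 / μ * x)).inv₀ (Real.exp_pos _).ne'
  rw [← Real.exp_neg] at h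
  refine h.congr' ?_
  have hb : ∀ᶠ r : ℝ in atTop, 0 ≤ 1 + 1 / μ * x / r := by
    have : Tendsto (fun r : ℝ => 1 + 1 / μ * x / r) atTop (𝓝 (1 + 0)) :=
      tendsto_const_nhds.add (tendsto_const_nhds.div_atTop tendsto_id)
    rw [add_zero] at this
    exact (this.eventually (lt_mem_nhds one_pos)).mono fun _ h => le_of_lt h
  filter_upwards [hb, eventually_gt_atTop 0] with r hr hr0
  have e : 1 + 1 / μ * x / r = (μ + x / r) / μ := by field_simp
  rw [← Real.inv_rpow hr, e, inv_div]

theorem tendsto_integral_one_sub_div_add_div_rpow {α p μ : ℝ} (hp0 : 0 < p) (hpα : p < α)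
    (hμ : 0 < μ) :
    Tendsto (fun r : ℝ => ∫ v in Set.Ioi (0 : ℝ),
        (1 - (μ / (μ + v ^ α / r)) ^ r) * v ^ (-p - 1)) atTop
      (𝓝 ((1 / μ) ^ (p / α) * (Real.Gamma (1 - p / α) / p))) := by
  rw [← integral_one_sub_exp_rpow_mul_rpow hp0 hpα (by positivity)]
  refine tendsto_integral_filter_of_dominated_convergence
    (fun u : ℝ => (1 - Real.exp (-(1 / μ * u ^ α))) * u ^ (-p - 1))
    (Eventually.of_forall fun r => by fun_prop) ?_
    (integrableOn_one_sub_exp_rpow_mul_rpow hp0 hpα (by positivity)) ?_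
  · filter_upwards [eventually_gt_atTop 0] with r hr
    filter_upwards [self_mem_ae_restrict measurableSet_Ioi] with u hu
    have hu0 := Real.rpow_nonneg (le_of_lt hu) α
    have h := norm_one_sub_div_add_rpow_mul_rpow_le (q := -p - 1) hμ hr.le
      (x := u ^ α / r) (by positivity) (le_of_lt hu)
    -- Here `r` cancels, so the majorant is the same for all `r` and equals the limit integrand.
    have e : r * (u ^ α / r) / μ = 1 / μ * u ^ α := by field_simp
    rwa [e] at h
  · exact ae_of_all _ fun u =>
      ((tendsto_div_add_div_rpow hμ (u ^ α)).const_sub 1).mul_const _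

namespace IsMittagLefflerSubordinator

variable {Ω : Type*} [MeasurableSpace Ω] {P : Measure Ω} [IsProbabilityMeasure P]
  {α ρ μ : ℝ} {M : ℝ≥0 → Ω → ℝ≥0}

theorem lintegral_one_sub_exp (h : IsMittagLefflerSubordinator α ρ μ M P) (t : ℝ≥0) {u : ℝ}
    (hu : 0 ≤ u) :
    ∫⁻ ω, ENNReal.ofReal (1 - Real.exp (-(u * M t ω))) ∂P
      = ENNReal.ofReal (1 - (μ / (μ + u ^ α)) ^ (ρ * t)) := by
  have hm := h.measurable t
  have hle (ω : Ω) : Real.exp (-(u * M t ω)) ≤ 1 :=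
    Real.exp_le_one_iff.2 (neg_nonpos.2 (mul_nonneg hu (M t ω).coe_nonneg))
  have hI : Integrable (fun ω => Real.exp (-(u * M t ω))) P := by
    refine Integrable.of_bound (by fun_prop) 1 (ae_of_all _ fun ω => ?_)
    rw [Real.norm_eq_abs, Real.abs_exp]
    exact hle ω
  have hI' : Integrable (fun ω => 1 - Real.exp (-(u * M t ω))) P := (integrable_const 1).sub hI
  rw [← ofReal_integral_eq_lintegral_ofReal hI' (ae_of_all _ fun ω => sub_nonneg.2 (hle ω)),
    integral_sub (integrable_const 1) hI, h.laplace t u hu]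
  simp

/-- Insert the integral representation of `x ^ p` and exchange it with the expectation, which leaves
the Laplace transform. This holds in `[0, ∞]` for all `0 < p < 1`. -/
theorem lintegral_rpow_mul (h : IsMittagLefflerSubordinator α ρ μ M P) {p : ℝ} (hp0 : 0 < p)
    (hp1 : p < 1) (t : ℝ≥0) :
    ∫⁻ ω, ENNReal.ofReal ((M t ω : ℝ) ^ p * (Real.Gamma (1 - p) / p)) ∂P
      = ∫⁻ u in Set.Ioi (0 : ℝ),
        ENNReal.ofReal ((1 - (μ / (μ + u ^ α)) ^ (ρ * t)) * u ^ (-p - 1)) := by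
  have hm := h.measurable t
  have h1 (ω : Ω) := lintegral_one_sub_exp_mul_rpow hp0 hp1 (M t ω).coe_nonneg
  simp_rw [← h1]
  rw [lintegral_lintegral_swap (by fun_prop)]
  refine setLIntegral_congr_fun measurableSet_Ioi fun u hu => ?_
  have hu' := Real.rpow_nonneg (le_of_lt hu) (-p - 1)
  simp only [ENNReal.ofReal_mul' hu']
  rw [lintegral_mul_const _ (by fun_prop), h.lintegral_one_sub_exp t (le_of_lt hu)]

theorem integrable_rpow_and_integral_eq (h : IsMittagLefflerSubordinator α ρ μ M P) (hα : α < 1)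
    (hρ : 0 < ρ) (hμ : 0 < μ) {p : ℝ} (hp0 : 0 < p) (hpα : p < α) (t : ℝ≥0) :
    Integrable (fun ω => (M t ω : ℝ) ^ p) P ∧
      ∫ ω, (M t ω : ℝ) ^ p ∂P = p / Real.Gamma (1 - p) * ∫ u in Set.Ioi (0 : ℝ),
        (1 - (μ / (μ + u ^ α)) ^ (ρ * t)) * u ^ (-p - 1) := by
  have hm := h.measurable t
  have hp1 := hpα.trans hα
  have hΓ := Real.Gamma_pos_of_pos (show 0 < 1 - p by linarith)
  have hnn : ∀ u ∈ Set.Ioi (0 : ℝ), 0 ≤ (1 - (μ / (μ + u ^ α)) ^ (ρ * t)) * u ^ (-p - 1) :=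
    fun u hu => mul_nonneg (sub_nonneg.2 (div_add_rpow_le_one hμ (by positivity)
      (Real.rpow_nonneg (le_of_lt hu) _))) (Real.rpow_nonneg (le_of_lt hu) _)
  have key := h.lintegral_rpow_mul hp0 hp1 t
  have hnn' : ∀ ω, 0 ≤ (M t ω : ℝ) ^ p * (Real.Gamma (1 - p) / p) := fun ω => by positivity
  have hr : 0 ≤ ρ * (t : ℝ) := by positivity
  rw [← ofReal_integral_eq_lintegral_ofReal
    (integrableOn_one_sub_div_add_rpow_mul_rpow hp0 hpα hμ hr)
    ((ae_restrict_iff' measurableSet_Ioi).2 (ae_of_all _ hnn))] at key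
  have hI : Integrable (fun ω => (M t ω : ℝ) ^ p * (Real.Gamma (1 - p) / p)) P :=
    (lintegral_ofReal_ne_top_iff_integrable
      ((hm.coe_nnreal_real.pow_const p).mul_const _).aestronglyMeasurable (ae_of_all _ hnn')).1
      (by rw [key]; exact ENNReal.ofReal_ne_top)
  have hI' : Integrable (fun ω => (M t ω : ℝ) ^ p) P :=
    (integrable_mul_const_iff (by exact (IsUnit.mk0 _ (by positivity))) _).1 hI
  refine ⟨hI', ?_⟩
  rw [← ofReal_integral_eq_lintegral_ofReal hI (ae_of_all _ hnn'),
    ENNReal.ofReal_eq_ofReal_iff (integral_nonneg hnn') (setIntegral_nonneg measurableSet_Ioi hnn),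
    integral_mul_const] at key
  rw [← key]
  field_simp

theorem isEquivalent_integral_rpow (h : IsMittagLefflerSubordinator α ρ μ M P) (hα : α < 1)
    (hρ : 0 < ρ) (hμ : 0 < μ) {p : ℝ} (hp0 : 0 < p) (hpα : p < α) :
    (fun t : ℝ≥0 => ∫ ω, (M t ω : ℝ) ^ p ∂P) ~[atTop] fun t : ℝ≥0 =>
      Real.Gamma (1 - p / α) / (μ ^ (p / α) * Real.Gamma (1 - p)) * (ρ * t) ^ (p / α) := by
  have hα0 := hp0.trans hpα
  have hΓ := Real.Gamma_pos_of_pos (show 0 < 1 - p by linarith)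
  have hΓ' := Real.Gamma_pos_of_pos (show 0 < 1 - p / α by
    have := (div_lt_one hα0).2 hpα; linarith)
  have hlim : Tendsto (fun t : ℝ≥0 => ρ * (t : ℝ)) atTop atTop :=
    Tendsto.const_mul_atTop hρ (NNReal.tendsto_coe_atTop.2 tendsto_id)
  have hJ := ((tendsto_integral_one_sub_div_add_div_rpow hp0 hpα hμ).comp hlim).const_mul
    (p / Real.Gamma (1 - p))
  have hc : p / Real.Gamma (1 - p) * ((1 / μ) ^ (p / α) * (Real.Gamma (1 - p / α) / p))
      = Real.Gamma (1 - p / α) / (μ ^ (p / α) * Real.Gamma (1 - p)) := by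
    rw [one_div, Real.inv_rpow hμ.le]
    field_simp
  rw [hc] at hJ
  have hc0 : Real.Gamma (1 - p / α) / (μ ^ (p / α) * Real.Gamma (1 - p)) ≠ 0 := by positivity
  refine (((isEquivalent_const_iff_tendsto hc0).2 hJ).mul
    (IsEquivalent.refl (u := fun t : ℝ≥0 => (ρ * (t : ℝ)) ^ (p / α)))).congr_left ?_
  filter_upwards [eventually_gt_atTop 0] with t ht
  have hr : 0 < ρ * (t : ℝ) := mul_pos hρ ht
  rw [(h.integrable_rpow_and_integral_eq hα hρ hμ hp0 hpα t).2,
    integral_one_sub_div_add_rpow_mul_rpow_scaled hα0 hr]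
  simp only [Pi.mul_apply, Function.comp]
  ring

end IsMittagLefflerSubordinator

/-! ### Moments of the time-changed process -/

theorem continuous_incompleteBeta {r p : ℝ} (hr : 0 < r) (hp : 1 ≤ p) :
    Continuous (incompleteBeta r p) :=
  intervalIntegral.continuous_primitive (fun a b =>
    (intervalIntegrable_rpow_mul_sub_rpow hr hp a 1).symm.trans
      (intervalIntegrable_rpow_mul_sub_rpow hr hp b 1)) 0

theorem incompleteBeta_nonneg (r p : ℝ) {x : ℝ} (h0 : 0 ≤ x) (h1 : x ≤ 1) :
    0 ≤ incompleteBeta r p x :=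
  intervalIntegral.integral_nonneg h0 fun u hu =>
    mul_nonneg (Real.rpow_nonneg hu.1 _) (Real.rpow_nonneg (by linarith [hu.2]) _)

theorem incompleteBeta_le_beta {r p : ℝ} (hr : 0 < r) (hp : 1 ≤ p) {x : ℝ} (h0 : 0 ≤ x)
    (h1 : x ≤ 1) : incompleteBeta r p x ≤ beta r p := by
  rw [← incompleteBeta_one hr (by linarith)]
  refine intervalIntegral.integral_mono_interval le_rfl h0 h1 ?_
    (intervalIntegrable_rpow_mul_sub_rpow hr hp 1 1)
  filter_upwards [self_mem_ae_restrict measurableSet_Ioc] with u hu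
  exact mul_nonneg (Real.rpow_nonneg hu.1.le _) (Real.rpow_nonneg (by linarith [hu.2]) _)

/-- Outside `L²` both sides are infinite, whatever value the Bochner mean takes. -/
theorem evariance_add_ofReal_sq_integral {Ω : Type*} [MeasurableSpace Ω] {P : Measure Ω}
    [IsProbabilityMeasure P] {X : Ω → ℝ} (hX : AEStronglyMeasurable X P) :
    evariance X P + ENNReal.ofReal ((∫ ω, X ω ∂P) ^ 2) = ∫⁻ ω, ENNReal.ofReal (X ω ^ 2) ∂P := by
  by_cases h : MemLp X 2 P
  · rw [← ofReal_variance h, ← ENNReal.ofReal_add (variance_nonneg X P) (sq_nonneg _),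
      variance_eq_sub h, ← ofReal_integral_eq_lintegral_ofReal h.integrable_sq
      (ae_of_all _ fun ω => sq_nonneg _), sub_add_cancel]
    rfl
  · rw [evariance_eq_top hX h, top_add, eq_comm]
    by_contra hne
    exact h ((memLp_two_iff_integrable_sq hX).2
      ((lintegral_ofReal_ne_top_iff_integrable (hX.pow 2)
        (ae_of_all _ fun ω => sq_nonneg _)).1 hne))

theorem NNReal.coe_rpow_eq_ofReal (x : ℝ≥0) {p : ℝ} (hp : 0 ≤ p) :
    (x : ℝ≥0∞) ^ p = ENNReal.ofReal ((x : ℝ) ^ p) := by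
  rw [← ENNReal.ofReal_rpow_of_nonneg x.coe_nonneg hp, ENNReal.ofReal_coe_nnreal]

namespace IsGFNBP

variable {Ω : Type*} [MeasurableSpace Ω] {P : Measure Ω}
  {α β lam ρ μ q d : ℝ} {G : ℝ≥0 → Ω → ℕ} {M : ℝ≥0 → Ω → ℝ≥0}

theorem integrable_rpow_mul_incompleteBeta (hG : IsGFNBP α β lam ρ μ G M P) (hβ0 : 0 < β)
    {s t : ℝ≥0} (hst : s ≤ t) (hM2 : Integrable (fun ω => (M t ω : ℝ) ^ (2 * β)) P) :
    Integrable (fun ω => (M t ω : ℝ) ^ (2 * β) *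
          incompleteBeta β (1 + β) ((M s ω : ℝ) / M t ω)) P := by
  have hM := hG.subordinator.measurable
  refine hM2.mul_bdd (c := beta β (1 + β)) ?_ ?_
  · exact ((continuous_incompleteBeta hβ0 (by linarith)).measurable.comp
      ((hM s).coe_nnreal_real.div (hM t).coe_nnreal_real)).aestronglyMeasurable
  · filter_upwards [hG.subordinator.paths] with ω hω
    have h0 : (0 : ℝ) ≤ (M s ω : ℝ) / M t ω := by positivity
    have h1 : (M s ω : ℝ) / M t ω ≤ 1 :=
      div_le_one_of_le₀ (NNReal.coe_le_coe.2 (hω.1 hst)) (M t ω).coe_nonneg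
    rw [Real.norm_of_nonneg (incompleteBeta_nonneg _ _ h0 h1)]
    exact incompleteBeta_le_beta hβ0 (by linarith) h0 h1

variable [IsProbabilityMeasure P]

theorem aemeasurable (hG : IsGFNBP α β lam ρ μ G M P) (hβ0 : 0 < β) (hlam : 0 < lam) (t : ℝ≥0) :
    AEMeasurable (G t) P := by
  obtain ⟨N, hN, -, rfl⟩ := hG.timeChanged
  exact hN.aemeasurable_timeChange hβ0 hlam hG.subordinator.measurable t

theorem lintegral_eq (hG : IsGFNBP α β lam ρ μ G M P) (hβ0 : 0 < β) (hlam : 0 < lam)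
    (hq : q = lam / Real.Gamma (1 + β)) (t : ℝ≥0) :
    ∫⁻ ω, (G t ω : ℝ≥0∞) ∂P = ENNReal.ofReal q * ∫⁻ ω, (M t ω : ℝ≥0∞) ^ β ∂P := by
  have hΓ : 0 < Real.Gamma (1 + β) := Real.Gamma_pos_of_pos (by positivity)
  obtain ⟨N, hN, hNM, rfl⟩ := hG.timeChanged
  have hM := hG.subordinator.measurable
  rw [hN.lintegral_timeChange hβ0 hlam hM hNM (fun n _ => n) t t,
    ← lintegral_const_mul' _ _ ENNReal.ofReal_ne_top]
  refine lintegral_congr fun ω => ?_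
  rw [hN.lintegral_eq hβ0 hlam, NNReal.coe_rpow_eq_ofReal _ hβ0.le, hq,
    ENNReal.ofReal_mul (by positivity)]

theorem lintegral_mul_eq (hG : IsGFNBP α β lam ρ μ G M P) (hβ0 : 0 < β) (hlam : 0 < lam)
    (hq : q = lam / Real.Gamma (1 + β)) (hd : d = β * q ^ 2 * beta β (1 + β))
    {s t : ℝ≥0} (hst : s ≤ t) :
    ∫⁻ ω, (G s ω : ℝ≥0∞) * (G t ω : ℝ≥0∞) ∂P =
        ENNReal.ofReal q * ∫⁻ ω, (M s ω : ℝ≥0∞) ^ β ∂P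
          + ENNReal.ofReal d * ∫⁻ ω, (M s ω : ℝ≥0∞) ^ (2 * β) ∂P
          + ENNReal.ofReal (q ^ 2 * β) * ∫⁻ ω, (M t ω : ℝ≥0∞) ^ (2 * β) *
              ENNReal.ofReal (incompleteBeta β (1 + β) ((M s ω : ℝ) / M t ω)) ∂P := by
  have hΓ : 0 < Real.Gamma (1 + β) := Real.Gamma_pos_of_pos (by positivity)
  have hq0 : 0 < q := by rw [hq]; positivity
  have hb := beta_pos hβ0 (show 0 < 1 + β by positivity)
  obtain ⟨N, hN, hNM, rfl⟩ := hG.timeChanged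
  have hM := hG.subordinator.measurable
  have hMs := (hM s).coe_nnreal_ennreal
  have hm2 : Measurable fun ω => ENNReal.ofReal q * (M s ω : ℝ≥0∞) ^ β
      + ENNReal.ofReal d * (M s ω : ℝ≥0∞) ^ (2 * β) :=
    ((hMs.pow_const β).const_mul _).add ((hMs.pow_const (2 * β)).const_mul _)
  rw [hN.lintegral_timeChange hβ0 hlam hM hNM (fun n m => (n : ℝ≥0∞) * m) s t,
    ← lintegral_const_mul' _ _ ENNReal.ofReal_ne_top,
    ← lintegral_const_mul' _ _ ENNReal.ofReal_ne_top,
    ← lintegral_const_mul' _ _ ENNReal.ofReal_ne_top,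
    ← lintegral_add_left ((hMs.pow_const β).const_mul _),
    ← lintegral_add_left hm2]
  refine lintegral_congr_ae ?_
  filter_upwards [hG.subordinator.paths] with ω hω
  have hle : M s ω ≤ M t ω := hω.1 hst
  rw [hN.lintegral_mul_eq hβ0 hlam hle, NNReal.coe_rpow_eq_ofReal _ hβ0.le,
    NNReal.coe_rpow_eq_ofReal _ (by positivity), NNReal.coe_rpow_eq_ofReal _ (by positivity),
    ← hq, add_right_comm, ENNReal.ofReal_mul hq0.le,
    ENNReal.ofReal_mul (show 0 ≤ q ^ 2 * β by positivity),
    ENNReal.ofReal_mul (show 0 ≤ q ^ 2 * β by positivity),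
    ENNReal.ofReal_mul (show (0 : ℝ) ≤ (M t ω : ℝ) ^ (2 * β) by positivity)]
  congr 2
  -- If the clock is still at `0`, then `s / s` reads `0 / 0 = 0` and not `1`, but the factor `M s ^
  -- (2β)` vanishes.
  rcases eq_or_ne (M s ω : ℝ) 0 with h0 | h0
  · simp [h0, Real.zero_rpow (show 2 * β ≠ 0 by positivity)]
  · rw [div_self h0, incompleteBeta_one hβ0 (by positivity),
      ← ENNReal.ofReal_mul (show 0 ≤ q ^ 2 * β by positivity),
      ← ENNReal.ofReal_mul (by rw [hd]; positivity), hd]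
    congr 1; ring

/-- On the diagonal the incomplete beta function is complete wherever `M t ≠ 0`, so the two
second-order terms coincide and `d` is doubled. -/
theorem lintegral_sq_eq (hG : IsGFNBP α β lam ρ μ G M P) (hβ0 : 0 < β) (hlam : 0 < lam)
    (hq : q = lam / Real.Gamma (1 + β)) (hd : d = β * q ^ 2 * beta β (1 + β)) (t : ℝ≥0) :
    ∫⁻ ω, ENNReal.ofReal ((G t ω : ℝ) ^ 2) ∂P =
        ENNReal.ofReal q * ∫⁻ ω, (M t ω : ℝ≥0∞) ^ β ∂P
          + ENNReal.ofReal (2 * d) * ∫⁻ ω, (M t ω : ℝ≥0∞) ^ (2 * β) ∂P := by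
  have hΓ : 0 < Real.Gamma (1 + β) := Real.Gamma_pos_of_pos (by positivity)
  have hq0 : 0 < q := by rw [hq]; positivity
  have hb := beta_pos hβ0 (show 0 < 1 + β by positivity)
  have hd0 : 0 ≤ d := by rw [hd]; positivity
  have h1 (ω : Ω) : ENNReal.ofReal ((G t ω : ℝ) ^ 2) = (G t ω : ℝ≥0∞) * (G t ω : ℝ≥0∞) := by
    rw [ENNReal.ofReal_pow (Nat.cast_nonneg _), ENNReal.ofReal_natCast, sq]
  have h2 (ω : Ω) : (M t ω : ℝ≥0∞) ^ (2 * β) *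
        ENNReal.ofReal (incompleteBeta β (1 + β) ((M t ω : ℝ) / M t ω))
      = (M t ω : ℝ≥0∞) ^ (2 * β) * ENNReal.ofReal (beta β (1 + β)) := by
    rcases eq_or_ne (M t ω) 0 with h0 | h0
    · simp [h0, ENNReal.zero_rpow_of_pos (show 0 < 2 * β by positivity)]
    · rw [div_self (NNReal.coe_ne_zero.2 h0), incompleteBeta_one hβ0 (by positivity)]
  simp_rw [h1]
  rw [hG.lintegral_mul_eq hβ0 hlam hq hd le_rfl]
  simp_rw [h2]
  rw [lintegral_mul_const' _ _ ENNReal.ofReal_ne_top, mul_comm _ (ENNReal.ofReal (beta _ _)),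
    ← mul_assoc, ← ENNReal.ofReal_mul (by positivity), add_assoc, ← add_mul,
    ← ENNReal.ofReal_add hd0 (by positivity)]
  congr 3
  rw [hd]; ring

theorem integrable_and_integral_eq (hG : IsGFNBP α β lam ρ μ G M P) (hβ0 : 0 < β) (hlam : 0 < lam)
    (hq : q = lam / Real.Gamma (1 + β)) {t : ℝ≥0}
    (hM : Integrable (fun ω => (M t ω : ℝ) ^ β) P) :
    Integrable (fun ω => (G t ω : ℝ)) P ∧
      ∫ ω, (G t ω : ℝ) ∂P = q * ∫ ω, (M t ω : ℝ) ^ β ∂P := by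
  have hΓ : 0 < Real.Gamma (1 + β) := Real.Gamma_pos_of_pos (by positivity)
  have hq0 : 0 < q := by rw [hq]; positivity
  have hGm : AEMeasurable (fun ω => (G t ω : ℝ)) P :=
    (measurable_of_countable (fun n : ℕ => (n : ℝ))).comp_aemeasurable
      (hG.aemeasurable hβ0 hlam t)
  have h1 := hG.lintegral_eq hβ0 hlam hq t
  simp_rw [NNReal.coe_rpow_eq_ofReal _ hβ0.le, ← ENNReal.ofReal_natCast] at h1
  have hM0 : 0 ≤ ∫ ω, (M t ω : ℝ) ^ β ∂P := integral_nonneg fun ω => by positivity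
  rw [← ofReal_integral_eq_lintegral_ofReal hM (ae_of_all _ fun ω => by positivity),
    ← ENNReal.ofReal_mul hq0.le] at h1
  have hI : Integrable (fun ω => (G t ω : ℝ)) P :=
    (lintegral_ofReal_ne_top_iff_integrable hGm.aestronglyMeasurable
      (ae_of_all _ fun ω => Nat.cast_nonneg _)).1 (by rw [h1]; exact ENNReal.ofReal_ne_top)
  refine ⟨hI, ?_⟩
  rwa [← ofReal_integral_eq_lintegral_ofReal hI (ae_of_all _ fun ω => Nat.cast_nonneg _),
    ENNReal.ofReal_eq_ofReal_iff (integral_nonneg fun ω => Nat.cast_nonneg _)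
      (by positivity)] at h1

theorem memLp_two (hG : IsGFNBP α β lam ρ μ G M P) (hβ0 : 0 < β) (hlam : 0 < lam)
    {t : ℝ≥0} (hM : Integrable (fun ω => (M t ω : ℝ) ^ β) P)
    (hM2 : Integrable (fun ω => (M t ω : ℝ) ^ (2 * β)) P) :
    MemLp (fun ω => (G t ω : ℝ)) 2 P := by
  have hGm : AEMeasurable (fun ω => (G t ω : ℝ)) P :=
    (measurable_of_countable (fun n : ℕ => (n : ℝ))).comp_aemeasurable
      (hG.aemeasurable hβ0 hlam t)
  refine (memLp_two_iff_integrable_sq hGm.aestronglyMeasurable).2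
    ((lintegral_ofReal_ne_top_iff_integrable (hGm.pow_const 2).aestronglyMeasurable
      (ae_of_all _ fun ω => sq_nonneg _)).1 ?_)
  rw [hG.lintegral_sq_eq hβ0 hlam rfl rfl]
  simp_rw [NNReal.coe_rpow_eq_ofReal _ hβ0.le,
    NNReal.coe_rpow_eq_ofReal _ (show 0 ≤ 2 * β by positivity)]
  rw [← ofReal_integral_eq_lintegral_ofReal hM (ae_of_all _ fun ω => by positivity),
    ← ofReal_integral_eq_lintegral_ofReal hM2 (ae_of_all _ fun ω => by positivity)]
  exact ENNReal.add_ne_top.2 ⟨ENNReal.mul_ne_top ENNReal.ofReal_ne_top ENNReal.ofReal_ne_top,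
    ENNReal.mul_ne_top ENNReal.ofReal_ne_top ENNReal.ofReal_ne_top⟩

theorem evariance_add_eq (hG : IsGFNBP α β lam ρ μ G M P) (hβ0 : 0 < β) (hlam : 0 < lam)
    (hq : q = lam / Real.Gamma (1 + β)) (hd : d = β * q ^ 2 * beta β (1 + β)) {t : ℝ≥0}
    (hM : Integrable (fun ω => (M t ω : ℝ) ^ β) P) :
    evariance (fun ω => (G t ω : ℝ)) P
        + ENNReal.ofReal (q ^ 2 * (∫ ω, (M t ω : ℝ) ^ β ∂P) ^ 2) =
      ENNReal.ofReal (q * ∫ ω, (M t ω : ℝ) ^ β ∂P)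
        + ENNReal.ofReal (2 * d) * ∫⁻ ω, (M t ω : ℝ≥0∞) ^ (2 * β) ∂P := by
  have hΓ : 0 < Real.Gamma (1 + β) := Real.Gamma_pos_of_pos (by positivity)
  have hq0 : 0 < q := by rw [hq]; positivity
  have hGm : AEMeasurable (fun ω => (G t ω : ℝ)) P :=
    (measurable_of_countable (fun n : ℕ => (n : ℝ))).comp_aemeasurable
      (hG.aemeasurable hβ0 hlam t)
  rw [← mul_pow, ← (hG.integrable_and_integral_eq hβ0 hlam hq hM).2,
    evariance_add_ofReal_sq_integral hGm.aestronglyMeasurable,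
    hG.lintegral_sq_eq hβ0 hlam hq hd, (hG.integrable_and_integral_eq hβ0 hlam hq hM).2,
    ENNReal.ofReal_mul hq0.le,
    ofReal_integral_eq_lintegral_ofReal hM (ae_of_all _ fun ω => by positivity)]
  simp_rw [NNReal.coe_rpow_eq_ofReal _ hβ0.le]

/-- With both moments finite, the identity in `[0, ∞]` descends to the reals, where the squared mean
can be subtracted. -/
theorem variance_eq (hG : IsGFNBP α β lam ρ μ G M P) (hβ0 : 0 < β) (hlam : 0 < lam)
    (hq : q = lam / Real.Gamma (1 + β)) (hd : d = β * q ^ 2 * beta β (1 + β)) {t : ℝ≥0}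
    (hM : Integrable (fun ω => (M t ω : ℝ) ^ β) P)
    (hM2 : Integrable (fun ω => (M t ω : ℝ) ^ (2 * β)) P) :
    variance (fun ω => (G t ω : ℝ)) P =
      q * ∫ ω, (M t ω : ℝ) ^ β ∂P - q ^ 2 * (∫ ω, (M t ω : ℝ) ^ β ∂P) ^ 2
        + 2 * d * ∫ ω, (M t ω : ℝ) ^ (2 * β) ∂P := by
  have hΓ : 0 < Real.Gamma (1 + β) := Real.Gamma_pos_of_pos (by positivity)
  have hq0 : 0 < q := by rw [hq]; positivity
  have hb := beta_pos hβ0 (show 0 < 1 + β by positivity)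
  have hd0 : 0 ≤ d := by rw [hd]; positivity
  have h := hG.evariance_add_eq hβ0 hlam hq hd hM
  have hM0 : 0 ≤ ∫ ω, (M t ω : ℝ) ^ β ∂P := integral_nonneg fun ω => by positivity
  have hM20 : 0 ≤ ∫ ω, (M t ω : ℝ) ^ (2 * β) ∂P := integral_nonneg fun ω => by positivity
  simp_rw [NNReal.coe_rpow_eq_ofReal _ (show 0 ≤ 2 * β by positivity)] at h
  rw [← ofReal_variance (hG.memLp_two hβ0 hlam hM hM2),
    ← ofReal_integral_eq_lintegral_ofReal hM2 (ae_of_all _ fun ω => by positivity),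
    ← ENNReal.ofReal_mul (by positivity),
    ← ENNReal.ofReal_add (variance_nonneg _ _) (by positivity),
    ← ENNReal.ofReal_add (by positivity) (by positivity),
    ENNReal.ofReal_eq_ofReal_iff (add_nonneg (variance_nonneg _ _) (by positivity))
      (by positivity)] at h
  linarith

theorem covariance_eq (hG : IsGFNBP α β lam ρ μ G M P) (hβ0 : 0 < β) (hlam : 0 < lam)
    (hq : q = lam / Real.Gamma (1 + β)) (hd : d = β * q ^ 2 * beta β (1 + β))
    {s t : ℝ≥0} (hst : s ≤ t)
    (hM : ∀ r, Integrable (fun ω => (M r ω : ℝ) ^ β) P)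
    (hM2 : ∀ r, Integrable (fun ω => (M r ω : ℝ) ^ (2 * β)) P) :
    covariance (fun ω => (G s ω : ℝ)) (fun ω => (G t ω : ℝ)) P =
      q * ∫ ω, (M s ω : ℝ) ^ β ∂P + d * ∫ ω, (M s ω : ℝ) ^ (2 * β) ∂P
        - q ^ 2 * (∫ ω, (M s ω : ℝ) ^ β ∂P) * (∫ ω, (M t ω : ℝ) ^ β ∂P)
        + q ^ 2 * β * ∫ ω, (M t ω : ℝ) ^ (2 * β) *
            incompleteBeta β (1 + β) ((M s ω : ℝ) / M t ω) ∂P := by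
  have hΓ : 0 < Real.Gamma (1 + β) := Real.Gamma_pos_of_pos (by positivity)
  have hq0 : 0 < q := by rw [hq]; positivity
  have hb := beta_pos hβ0 (show 0 < 1 + β by positivity)
  have hd0 : 0 ≤ d := by rw [hd]; positivity
  have hGs := hG.memLp_two hβ0 hlam (hM s) (hM2 s)
  have hGt := hG.memLp_two hβ0 hlam (hM t) (hM2 t)
  have hB := hG.integrable_rpow_mul_incompleteBeta hβ0 hst (hM2 t)
  have hM0 : 0 ≤ ∫ ω, (M s ω : ℝ) ^ β ∂P := integral_nonneg fun ω => by positivity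
  have hM20 : 0 ≤ ∫ ω, (M s ω : ℝ) ^ (2 * β) ∂P := integral_nonneg fun ω => by positivity
  have hBnn : ∀ᵐ ω ∂P, 0 ≤ (M t ω : ℝ) ^ (2 * β) *
      incompleteBeta β (1 + β) ((M s ω : ℝ) / M t ω) := by
    filter_upwards [hG.subordinator.paths] with ω hω
    exact mul_nonneg (by positivity) (incompleteBeta_nonneg _ _ (by positivity)
      (div_le_one_of_le₀ (NNReal.coe_le_coe.2 (hω.1 hst)) (M t ω).coe_nonneg))
  have hB0 := integral_nonneg_of_ae hBnn
  have h := hG.lintegral_mul_eq hβ0 hlam hq hd hst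
  have hcast (ω : Ω) : (G s ω : ℝ≥0∞) * (G t ω : ℝ≥0∞)
      = ENNReal.ofReal ((G s ω : ℝ) * G t ω) := by
    rw [ENNReal.ofReal_mul (Nat.cast_nonneg _), ENNReal.ofReal_natCast, ENNReal.ofReal_natCast]
  have hGI : Integrable (fun ω => (G s ω : ℝ) * G t ω) P := hGs.integrable_mul hGt
  simp_rw [hcast, NNReal.coe_rpow_eq_ofReal _ (show 0 ≤ 2 * β by positivity),
    NNReal.coe_rpow_eq_ofReal _ hβ0.le] at h
  simp_rw [← ENNReal.ofReal_mul (Real.rpow_nonneg (NNReal.coe_nonneg _) (2 * β))] at h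
  rw [← ofReal_integral_eq_lintegral_ofReal hGI (ae_of_all _ fun ω => by positivity),
    ← ofReal_integral_eq_lintegral_ofReal (hM s) (ae_of_all _ fun ω => by positivity),
    ← ofReal_integral_eq_lintegral_ofReal (hM2 s) (ae_of_all _ fun ω => by positivity),
    ← ofReal_integral_eq_lintegral_ofReal hB hBnn,
    ← ENNReal.ofReal_mul hq0.le, ← ENNReal.ofReal_mul hd0, ← ENNReal.ofReal_mul (by positivity),
    ← ENNReal.ofReal_add (by positivity) (by positivity),
    ← ENNReal.ofReal_add (by positivity) (by positivity),
    ENNReal.ofReal_eq_ofReal_iff (integral_nonneg fun ω => by positivity)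
      (by positivity)] at h
  rw [covariance_eq_sub hGs hGt, (hG.integrable_and_integral_eq hβ0 hlam hq (hM s)).2,
    (hG.integrable_and_integral_eq hβ0 hlam hq (hM t)).2]
  simp only [Pi.mul_apply]
  rw [h]
  ring

end IsGFNBP

theorem theorem1 {Ω : Type*} [MeasurableSpace Ω] {P : Measure Ω} [IsProbabilityMeasure P]
    {α β lam ρ μ : ℝ} (hα0 : 0 < α) (hα1 : α < 1) (hβ0 : 0 < β) (hβ1 : β ≤ 1)
    (hlam : 0 < lam) (hρ : 0 < ρ) (hμ : 0 < μ)
    {G : ℝ≥0 → Ω → ℕ} {M : ℝ≥0 → Ω → ℝ≥0} (hG : IsGFNBP α β lam ρ μ G M P)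
    {q d : ℝ} (hq : q = lam / Real.Gamma (1 + β)) (hd : d = β * q ^ 2 * beta β (1 + β)) :
    -- mean and mixed second moment, as identities in `[0, ∞]`
    (∀ t : ℝ≥0, 0 < t →
      ∫⁻ ω, (G t ω : ℝ≥0∞) ∂P = ENNReal.ofReal q * ∫⁻ ω, (M t ω : ℝ≥0∞) ^ β ∂P) ∧
    (∀ s t : ℝ≥0, 0 < s → s ≤ t →
      ∫⁻ ω, (G s ω : ℝ≥0∞) * (G t ω : ℝ≥0∞) ∂P =
        ENNReal.ofReal q * ∫⁻ ω, (M s ω : ℝ≥0∞) ^ β ∂P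
          + ENNReal.ofReal d * ∫⁻ ω, (M s ω : ℝ≥0∞) ^ (2 * β) ∂P
          + ENNReal.ofReal (q ^ 2 * β) * ∫⁻ ω, (M t ω : ℝ≥0∞) ^ (2 * β) *
              ENNReal.ofReal (incompleteBeta β (1 + β) ((M s ω : ℝ) / M t ω)) ∂P) ∧
    -- (i) the mean, and (ii) the variance in `[0, ∞]`, for `β < α`
    (β < α →
      (∀ t : ℝ≥0, 0 < t →
        Integrable (fun ω => (G t ω : ℝ)) P ∧
        Integrable (fun ω => (M t ω : ℝ) ^ β) P ∧
        ∫ ω, (G t ω : ℝ) ∂P = q * ∫ ω, (M t ω : ℝ) ^ β ∂P ∧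
        evariance (fun ω => (G t ω : ℝ)) P
            + ENNReal.ofReal (q ^ 2 * (∫ ω, (M t ω : ℝ) ^ β ∂P) ^ 2) =
          ENNReal.ofReal (q * ∫ ω, (M t ω : ℝ) ^ β ∂P)
            + ENNReal.ofReal (2 * d) * ∫⁻ ω, (M t ω : ℝ≥0∞) ^ (2 * β) ∂P) ∧
      (fun t : ℝ≥0 => ∫ ω, (G t ω : ℝ) ∂P) ~[atTop] fun t : ℝ≥0 =>
        q * Real.Gamma (1 - β / α) / (μ ^ (β / α) * Real.Gamma (1 - β)) * (ρ * t) ^ (β / α)) ∧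
    -- (ii) the variance and (iii) the autocovariance as real numbers, for `2 * β < α`
    (2 * β < α →
      (∀ t : ℝ≥0, 0 < t →
        MemLp (fun ω => (G t ω : ℝ)) 2 P ∧
        Integrable (fun ω => (M t ω : ℝ) ^ (2 * β)) P ∧
        variance (fun ω => (G t ω : ℝ)) P =
          q * ∫ ω, (M t ω : ℝ) ^ β ∂P - q ^ 2 * (∫ ω, (M t ω : ℝ) ^ β ∂P) ^ 2
            + 2 * d * ∫ ω, (M t ω : ℝ) ^ (2 * β) ∂P) ∧
      (∀ s t : ℝ≥0, 0 < s → s ≤ t →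
        Integrable (fun ω => (M t ω : ℝ) ^ (2 * β) *
          incompleteBeta β (1 + β) ((M s ω : ℝ) / M t ω)) P ∧
        covariance (fun ω => (G s ω : ℝ)) (fun ω => (G t ω : ℝ)) P =
          q * ∫ ω, (M s ω : ℝ) ^ β ∂P + d * ∫ ω, (M s ω : ℝ) ^ (2 * β) ∂P
            - q ^ 2 * (∫ ω, (M s ω : ℝ) ^ β ∂P) * (∫ ω, (M t ω : ℝ) ^ β ∂P)
            + q ^ 2 * β * ∫ ω, (M t ω : ℝ) ^ (2 * β) *
                incompleteBeta β (1 + β) ((M s ω : ℝ) / M t ω) ∂P)) := by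
  -- All finiteness claims reduce to the moments of `M` of orders `β` and `2β`.
  have hM {p : ℝ} (hp0 : 0 < p) (hpα : p < α) (t : ℝ≥0) :
      Integrable (fun ω => (M t ω : ℝ) ^ p) P :=
    (hG.subordinator.integrable_rpow_and_integral_eq hα1 hρ hμ hp0 hpα t).1
  refine ⟨fun t _ => hG.lintegral_eq hβ0 hlam hq t,
    fun s t _ hst => hG.lintegral_mul_eq hβ0 hlam hq hd hst, fun hβα => ⟨fun t _ => ?_, ?_⟩,
    fun hβα => ?_⟩
  · have h := hG.integrable_and_integral_eq hβ0 hlam hq (hM hβ0 hβα t)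
    exact ⟨h.1, hM hβ0 hβα t, h.2, hG.evariance_add_eq hβ0 hlam hq hd (hM hβ0 hβα t)⟩
  · have h := (IsEquivalent.refl (u := fun _ : ℝ≥0 => q) (l := atTop)).mul
      (hG.subordinator.isEquivalent_integral_rpow hα1 hρ hμ hβ0 hβα)
    convert h using 1
    · ext t
      exact (hG.integrable_and_integral_eq hβ0 hlam hq (hM hβ0 hβα t)).2
    · ext t
      simp only [Pi.mul_apply]
      ring
  · have h2β : 0 < 2 * β := by positivity
    have hβα' : β < α := by linarith
    exact ⟨fun t _ => ⟨hG.memLp_two hβ0 hlam (hM hβ0 hβα' t) (hM h2β hβα t), hM h2β hβα t,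
        hG.variance_eq hβ0 hlam hq hd (hM hβ0 hβα' t) (hM h2β hβα t)⟩,
      fun s t _ hst => ⟨hG.integrable_rpow_mul_incompleteBeta hβ0 hst (hM h2β hβα t),
        hG.covariance_eq hβ0 hlam hq hd hst (hM hβ0 hβα') (hM h2β hβα)⟩⟩
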